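/- Let $a>0$, $X=[a,a+1]^2\subset\mathbb R^2$, and let $u:X\to[0,\infty)$ be convex and coordinatewise nondecreasing. Suppose that there are constants $C_0$ and $t_{0.5}<t_{1.5}$ with $2a<t_{0.5}$ and $t_{1.5}<2a+2$ such that, with $$\Omega_0=\{x\in X: x_1+x_2\le t_{0.5}\},\quad \Omega_1=\{x\in X: t_{0.5}<x_1+x_2\le t_{1.5}\},\quad \Omega_2=\{x\in X: t_{1.5}<x_1+x_2\},$$ the following hold: (i) $u=0$ on $\Omega_0$; (ii) $u(x)=u_1(x):=U(x_1+x_2)$ on $\Omega_1$, where $U(t)=\frac38t^2-\frac12at-\frac12\log|t-2a|+C_0$ and $U(t_{0.5})=0=U'(t_{0.5})$; (iii) the restriction $u_2$ of $u$ to $\Omega_2$ is of class $C^2$ on $\operatorname{int}\Omega_2$ and is a classical solution of $$\Delta u_2=3\ \text{ on }\operatorname{int}\Omega_2,\qquad (Du_2(x)-x)\cdot\hat n(x)=0\ \text{ on }\partial\Omega_2\cap\partial X,\qquad u_2-u_1=0\ \text{ on }\partial\Omega_1\cap\partial\Omega_2,$$ and satisfies the additional condition $D(u_2-u_1)\cdot\hat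 n=0$ on $\partial\Omega_1\cap\partial\Omega_2$. Here $\hat n$ is the outer unit normal of $\Omega_2$; the Dirichlet condition is understood as a limit from $\Omega_2$, and the conditions with $\hat n$ are required at the boundary points of $\Omega_2$ other than its corners and the endpoints of its edges, as one-sided normal derivatives from inside $\Omega_2$. Then $u$ is not continuously differentiable on $X$ up to the boundary, $u\notin C^1(X)$, and $u$ does not maximize $$\Phi[v]=\int_X\Big[x\cdot Dv(x)-v(x)-\tfrac12|Dv(x)|^2\Big]\,dx$$ among the convex, coordinatewise nondecreasing functions $v:X\to[0,\infty)$. -/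

import Mathlib

open Set Filter Topology MeasureTheory InnerProductSpace

noncomputable section

namespace RochetChone

/-- The plane of consumer types (and of products) with its Euclidean structure. -/
abbrev Plane : Type := EuclideanSpace ℝ (Fin 2)

/-- The first standard basis vector. -/
def e₁ : Plane := !₂[1, 0]

/-- The second standard basis vector. -/
def e₂ : Plane := !₂[0, 1]

/-- The closed square `[a, a+1]²`. -/
def square (a : ℝ) : Set Plane :=
  {x | x 0 ∈ Icc a (a + 1) ∧ x 1 ∈ Icc a (a + 1)}

/-- The exclusion region `{x ∈ [a, a+1]² : x₁ + x₂ ≤ t₀}`. -/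
def Ω₀ (a t₀ : ℝ) : Set Plane := {x | x ∈ square a ∧ x 0 + x 1 ≤ t₀}

/-- The bunching strip `{x ∈ [a, a+1]² : t₀ < x₁ + x₂ ≤ t₁}`. -/
def Ω₁ (a t₀ t₁ : ℝ) : Set Plane :=
  {x | x ∈ square a ∧ t₀ < x 0 + x 1 ∧ x 0 + x 1 ≤ t₁}

/-- The customization region `{x ∈ [a, a+1]² : t₁ < x₁ + x₂}`. -/
def Ω₂ (a t₁ : ℝ) : Set Plane := {x | x ∈ square a ∧ t₁ < x 0 + x 1}

/-- The profile `U(t) = 3t²/8 - at/2 - log|t - 2a|/2 + C₀`. -/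
def profile (a C₀ t : ℝ) : ℝ :=
  3 / 8 * t ^ 2 - 1 / 2 * a * t - 1 / 2 * Real.log |t - 2 * a| + C₀

/-- The utility in the strip, `u₁(x) = U(x₁ + x₂)`. -/
def stripUtility (a C₀ : ℝ) (x : Plane) : ℝ := profile a C₀ (x 0 + x 1)

/-- The outer normal derivative `Df(x) · n` of `f` at a boundary point `x` with outer unit
normal `n`, taken from inside the domain: the one-sided derivative at `h = 0` of
`h ↦ f (x + h n)`, `h ≤ 0`, exists and is equal to `d`. -/
def HasOuterNormalDeriv (f : Plane → ℝ) (x n : Plane) (d : ℝ) : Prop :=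
  HasDerivWithinAt (fun h : ℝ => f (x + h • n)) d (Iic 0) 0

/-- The outer unit normal of `Ω₂` along the segment `x₁ + x₂ = t₁`. -/
def stripNormal : Plane := -(1 / √2) • (e₁ + e₂)

/-- The three-region structure on `[a, a+1]²` with constant parameters `t₀ < t₁` and `C₀`. -/
structure Ansatz (a t₀ t₁ C₀ : ℝ) (u : Plane → ℝ) : Prop where
  /-- The triangle, the strip and the third region are all nondegenerate. -/
  lower : 2 * a < t₀
  middle : t₀ < t₁
  upper : t₁ < 2 * a + 2
  /-- Excluded customers. -/
  eq_zero : ∀ x ∈ Ω₀ a t₀, u x = 0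
  /-- Bunching along the anti-diagonals. -/
  eq_strip : ∀ x ∈ Ω₁ a t₀ t₁, u x = stripUtility a C₀ x
  /-- The matching conditions `U(t₀) = 0 = U'(t₀)`. -/
  profile_zero : profile a C₀ t₀ = 0
  profile_deriv_zero : HasDerivAt (profile a C₀) 0 t₀
  /-- The Poisson equation `Δu₂ = 3`, in the classical sense. -/
  contDiffOn : ContDiffOn ℝ 2 u (interior (Ω₂ a t₁))
  poisson : ∀ x ∈ interior (Ω₂ a t₁), Laplacian.laplacian u x = 3
  /-- The Neumann condition `(Du₂(x) - x) · n = 0` on the part of the boundary of `Ω₂` in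
  each of the four open edges of the square (left, right, bottom, top). -/
  neumann_left : ∀ x ∈ Ω₂ a t₁, x 0 = a → x 1 ∈ Ioo a (a + 1) →
    HasOuterNormalDeriv u x (-e₁) (inner ℝ x (-e₁))
  neumann_right : ∀ x ∈ Ω₂ a t₁, x 0 = a + 1 → x 1 ∈ Ioo a (a + 1) →
    HasOuterNormalDeriv u x e₁ (inner ℝ x e₁)
  neumann_bottom : ∀ x ∈ Ω₂ a t₁, x 1 = a → x 0 ∈ Ioo a (a + 1) →
    HasOuterNormalDeriv u x (-e₂) (inner ℝ x (-e₂))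
  neumann_top : ∀ x ∈ Ω₂ a t₁, x 1 = a + 1 → x 0 ∈ Ioo a (a + 1) →
    HasOuterNormalDeriv u x e₂ (inner ℝ x e₂)
  /-- The Dirichlet condition `u₂ - u₁ = 0` on the segment between `Ω₁` and `Ω₂`, where `u₂`
  takes its boundary values as limits from `Ω₂`. -/
  dirichlet : ∀ x ∈ square a, x 0 + x 1 = t₁ →
    Tendsto u (𝓝[Ω₂ a t₁] x) (𝓝 (stripUtility a C₀ x))
  /-- The extra condition `D(u₂ - u₁) · n = 0` on the (open) segment between `Ω₁` and `Ω₂`. -/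
  extra : ∀ x ∈ interior (square a), x 0 + x 1 = t₁ →
    HasOuterNormalDeriv (fun y => u y - stripUtility a C₀ y) x stripNormal 0

/-- Indirect utilities on `X`: nonnegative, convex and coordinatewise nondecreasing. Only the
values on `X` matter. -/
structure Admissible (X : Set Plane) (u : Plane → ℝ) : Prop where
  nonneg : ∀ x ∈ X, 0 ≤ u x
  convexOn : ConvexOn ℝ X u
  mono : ∀ x ∈ X, ∀ y ∈ X, (∀ i, x i ≤ y i) → u x ≤ u y

/-- The profit `x · Du(x) - u(x) - c(Du(x))` earned from consumers of type `x`. -/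
def profitDensity (c : Plane → ℝ) (u : Plane → ℝ) (x : Plane) : ℝ :=
  inner ℝ x (gradient u x) - u x - c (gradient u x)

/-- The profit functional `Φ[u] = ∫ (x · Du - u - c(Du)) dμ`. -/
def profit (c : Plane → ℝ) (μ : Measure Plane) (u : Plane → ℝ) : ℝ :=
  ∫ x, profitDensity c u x ∂μ

/-- The uniform probability measure on `[a, a+1]²`. -/
def uniformSquare (a : ℝ) : Measure Plane := volume.restrict (square a)

/-- The quadratic cost `c(y) = |y|²/2`. -/
def quadraticCost (y : Plane) : ℝ := ‖y‖ ^ 2 / 2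

/-- `u` maximizes the profit functional of the square model among admissible utilities.
For an admissible `v` the part `x · Dv - v` of the density is integrable, so the density is
integrable or the profit of `v` is `-∞`; competitors of the second kind never matter, and a
maximizer has finite profit because `v = 0` has profit zero. -/
def IsProfitMaximizer (a : ℝ) (u : Plane → ℝ) : Prop :=
  Admissible (square a) u ∧
  Integrable (profitDensity quadraticCost u) (uniformSquare a) ∧
  ∀ v : Plane → ℝ, Admissible (square a) v →
    Integrable (profitDensity quadraticCost v) (uniformSquare a) →
    profit quadraticCost (uniformSquare a) v ≤ profit quadraticCost (uniformSquare a) u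

end RochetChone

end

/-!
The profile of the strip has slope `m = U'(t₁)` at the segment `x₁ + x₂ = t₁`, and everything turns on
whether `u` has a kink there, that is, whether its slope on the outer side is larger than `m`.

*Without a kink the problem in the third region is overdetermined.* By convexity the gradient of `u`
tends to `m (1, 1)` at the segment, so `u` and `W = 3r²/4 + m r`, where `r = x₁ + x₂ - t₁`, have the
same Laplacian and the same Cauchy data up to a constant. The complex gradient of `u - W` is holomorphic
and tends to zero at the segment. Such a function is zero: on a small square with one side on the
segment, the product of its four rotations by quarter turns vanishes on the whole boundary, hence inside
by the maximum principle (`eqOn_zero_of_eq_zero_bottom`). So `Du = DW` in the third region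
(`Ansatz.fderiv_eq`), and the normal derivative of `u` on the right edge of the square increases along
the edge, although the Neumann condition says that it is `a + 1` (`Ansatz.not_noKink`).

*A continuously differentiable `u` has no kink*, because its derivative across the segment is already
known from the side of the strip (`Ansatz.noKink_of_contDiffOn`).

*A maximizer has no kink.* Since `u` is convex, and constant on the segment, the kink has the same size
`κ` at all points of the segment (`Ansatz.noKink_or_kink`). Replace `u` by its maximum `u + g` with the
affine function of `x₁ + x₂` with gradient `q = (k, k)`, `k = m + κ/2`, and with value `U(t₁) + ε` on the
segment. Then `0 ≤ g ≤ ε`, and `g` is supported in a strip of width of order `ε`. The profit changes by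
`∫ (x - q) · Dg - g + |Dg|²/2`. Integration by parts on lines bounds the first part below by a multiple
of `-ε²`; the boundary of the square contributes no more than this because the support of `g` meets it
in length of order `ε` (`integral_deriv_prod_ge`). As `|Dg|` is bounded below on the side of the strip,
the quadratic part is at least a multiple of `ε`, so the profit increases for small `ε`
(`Ansatz.not_isProfitMaximizer_of_kink`).
-/

noncomputable section

namespace RochetChone

/-! ### The square and the profile -/

/-- The open square `(a, a+1)²`. -/
def openSquare (a : ℝ) : Set Plane :=
  {x | x 0 ∈ Ioo a (a + 1) ∧ x 1 ∈ Ioo a (a + 1)}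

lemma isOpen_openSquare (a : ℝ) : IsOpen (openSquare a) := by
  have h0 : Continuous fun x : Plane => x 0 := by fun_prop
  have h1 : Continuous fun x : Plane => x 1 := by fun_prop
  exact (isOpen_Ioo.preimage h0).inter (isOpen_Ioo.preimage h1)

lemma openSquare_subset_square (a : ℝ) : openSquare a ⊆ square a :=
  fun _ hx => ⟨Ioo_subset_Icc_self hx.1, Ioo_subset_Icc_self hx.2⟩

lemma openSquare_subset_interior (a : ℝ) : openSquare a ⊆ interior (square a) :=
  interior_maximal (openSquare_subset_square a) (isOpen_openSquare a)

lemma convex_openSquare (a : ℝ) : Convex ℝ (openSquare a) := by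
  intro x hx y hy s t hs ht hst
  exact ⟨by simpa using convex_Ioo a (a + 1) hx.1 hy.1 hs ht hst,
    by simpa using convex_Ioo a (a + 1) hx.2 hy.2 hs ht hst⟩

/-- The derivative `U'` of the profile. -/
def profileDeriv (a t : ℝ) : ℝ := 3 / 4 * t - a / 2 - 1 / (2 * (t - 2 * a))

lemma hasDerivAt_profile {a t : ℝ} (C₀ : ℝ) (ht : 2 * a < t) :
    HasDerivAt (profile a C₀) (profileDeriv a t) t := by
  have hne : t - 2 * a ≠ 0 := by linarith
  have h1 : HasDerivAt (fun t : ℝ => Real.log |t - 2 * a|) (1 / (t - 2 * a)) t := by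
    simp only [Real.log_abs]
    exact ((hasDerivAt_id t).sub_const (2 * a)).log hne
  have h2 := ((((hasDerivAt_id t).pow 2).const_mul (3 / 8 : ℝ)).sub
    ((hasDerivAt_id t).const_mul (1 / 2 * a))).sub (h1.const_mul (1 / 2 : ℝ)) |>.add_const C₀
  refine h2.congr_deriv ?_
  unfold profileDeriv
  simp
  field_simp
  ring

lemma profileDeriv_lt {a s t : ℝ} (hs : 2 * a < s) (hst : s < t) :
    profileDeriv a s < profileDeriv a t := by
  have : 1 / (2 * (t - 2 * a)) < 1 / (2 * (s - 2 * a)) :=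
    one_div_lt_one_div_of_lt (by linarith) (by linarith)
  unfold profileDeriv
  linarith

variable {a t₀ t₁ C₀ : ℝ} {u : Plane → ℝ}

lemma Ansatz.two_mul_lt (h : Ansatz a t₀ t₁ C₀ u) : 2 * a < t₁ := h.lower.trans h.middle

lemma Ansatz.profileDeriv_t₀ (h : Ansatz a t₀ t₁ C₀ u) : profileDeriv a t₀ = 0 :=
  (hasDerivAt_profile C₀ h.lower).unique h.profile_deriv_zero

lemma Ansatz.profileDeriv_pos (h : Ansatz a t₀ t₁ C₀ u) : 0 < profileDeriv a t₁ :=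
  h.profileDeriv_t₀ ▸ profileDeriv_lt h.lower h.middle

lemma Ansatz.profile_le (h : Ansatz a t₀ t₁ C₀ u) {t : ℝ} (ht₀ : t₀ < t) (ht₁ : t ≤ t₁) :
    profile a C₀ t ≤ profile a C₀ t₁ := by
  have hd : ∀ x ∈ Ioo t₀ t₁, HasDerivAt (profile a C₀) (profileDeriv a x) x := fun x hx =>
    hasDerivAt_profile C₀ (h.lower.trans hx.1)
  have hmono : MonotoneOn (profile a C₀) (Icc t₀ t₁) := by
    refine monotoneOn_of_deriv_nonneg (convex_Icc _ _) ?_ ?_ ?_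
    · exact fun x hx =>
        (hasDerivAt_profile C₀ (h.lower.trans_le hx.1)).continuousAt.continuousWithinAt
    · rw [interior_Icc]
      exact fun x hx => (hd x hx).differentiableAt.differentiableWithinAt
    · rw [interior_Icc]
      intro x hx
      rw [(hd x hx).deriv, ← h.profileDeriv_t₀]
      exact (profileDeriv_lt h.lower hx.1).le
  exact hmono ⟨ht₀.le, ht₁⟩ ⟨h.middle.le, le_rfl⟩ ht₁

lemma Ansatz.midpoint_mem (h : Ansatz a t₀ t₁ C₀ u) :
    (!₂[t₁ / 2, t₁ / 2] : Plane) ∈ openSquare a := by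
  have := h.two_mul_lt
  have := h.upper
  constructor <;> constructor <;> simp <;> linarith

lemma Ansatz.eq_profile (h : Ansatz a t₀ t₁ C₀ u) {x : Plane} (hx : x ∈ square a)
    (h₀ : t₀ < x 0 + x 1) (h₁ : x 0 + x 1 ≤ t₁) : u x = profile a C₀ (x 0 + x 1) :=
  h.eq_strip x ⟨hx, h₀, h₁⟩

/-- The utility lies above the affine function of `x₁ + x₂` which is tangent to the profile at
`t₁`: chords through the segment `x₁ + x₂ = t₁` are compared with the profile in the strip. -/
lemma Ansatz.tangent_le (h : Ansatz a t₀ t₁ C₀ u) (hu : Admissible (square a) u) {x : Plane}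
    (hx : x ∈ square a) :
    profile a C₀ t₁ + profileDeriv a t₁ * (x 0 + x 1 - t₁) ≤ u x := by
  set p : Plane := !₂[t₁ / 2, t₁ / 2] with hp
  have hpO : p ∈ openSquare a := h.midpoint_mem
  have hpS : p ∈ square a := openSquare_subset_square a hpO
  have hp01 : p 0 + p 1 = t₁ := by simp [hp]
  set r : ℝ := x 0 + x 1 - t₁ with hr
  have hup : u p = profile a C₀ t₁ := by
    rw [h.eq_profile hpS (by rw [hp01]; exact h.middle) hp01.le, hp01]
  -- the difference quotients of the profile along a line through `p`
  have hlim : ∀ ρ : ℝ, Tendsto (fun s : ℝ => s⁻¹ * (profile a C₀ (t₁ + s * ρ) - profile a C₀ t₁))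
      (𝓝[>] 0) (𝓝 (profileDeriv a t₁ * ρ)) := by
    intro ρ
    have h1 : HasDerivAt (fun s : ℝ => t₁ + s * ρ) ρ 0 := by
      simpa using ((hasDerivAt_id (0 : ℝ)).mul_const ρ).const_add t₁
    have h2 : HasDerivAt (fun s : ℝ => profile a C₀ (t₁ + s * ρ)) (profileDeriv a t₁ * ρ) 0 := by
      have h3 : HasDerivAt (profile a C₀) (profileDeriv a t₁) (t₁ + 0 * ρ) := by
        simpa using hasDerivAt_profile C₀ h.two_mul_lt
      exact h3.comp (0 : ℝ) h1
    simpa using h2.tendsto_slope_zero_right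
  have hstrip : ∀ ρ : ℝ, ∀ᶠ s : ℝ in 𝓝[>] 0, t₀ < t₁ + s * ρ := by
    intro ρ
    have : ContinuousAt (fun s : ℝ => t₁ + s * ρ) 0 := by fun_prop
    exact nhdsWithin_le_nhds (this.eventually (lt_mem_nhds (by simpa using h.middle)))
  rcases le_or_gt r 0 with hr0 | hr0
  · suffices profileDeriv a t₁ * r ≤ u x - profile a C₀ t₁ by linarith
    refine le_of_tendsto (hlim r) ?_
    filter_upwards [hstrip r, Ioo_mem_nhdsGT (zero_lt_one' ℝ)] with s hs hs01
    have hy := hu.convexOn.2 hpS hx (sub_nonneg.2 hs01.2.le) hs01.1.le (by ring)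
    have hyS := hu.convexOn.1 hpS hx (sub_nonneg.2 hs01.2.le) hs01.1.le (by ring)
    have hyt : ((1 - s) • p + s • x) 0 + ((1 - s) • p + s • x) 1 = t₁ + s * r := by
      simp only [PiLp.add_apply, PiLp.smul_apply, smul_eq_mul, hr, hp]
      simp
      ring
    have hneg : s * r ≤ 0 := mul_nonpos_of_nonneg_of_nonpos hs01.1.le hr0
    rw [h.eq_profile hyS (by rw [hyt]; exact hs) (by rw [hyt]; linarith), hyt, hup] at hy
    simp only [smul_eq_mul] at hy
    rw [inv_mul_le_iff₀ hs01.1]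
    linarith
  · suffices profile a C₀ t₁ - u x ≤ profileDeriv a t₁ * (-r) by linarith
    refine ge_of_tendsto (hlim (-r)) ?_
    have hO : ∀ᶠ s : ℝ in 𝓝[>] 0, p + s • (p - x) ∈ openSquare a := by
      have : ContinuousAt (fun s : ℝ => p + s • (p - x)) 0 := by fun_prop
      exact nhdsWithin_le_nhds (this.eventually
        ((isOpen_openSquare a).mem_nhds (by simpa using hpO)))
    filter_upwards [hstrip (-r), hO, self_mem_nhdsWithin] with s hs hsO (hs0 : 0 < s)
    have hyS := openSquare_subset_square a hsO
    have h1s : 0 < 1 + s := by linarith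
    have hc := hu.convexOn.2 hyS hx (one_div_pos.2 h1s).le (div_pos hs0 h1s).le (by field_simp)
    have hpe : (1 / (1 + s)) • (p + s • (p - x)) + (s / (1 + s)) • x = p := by
      have e : s = (1 + s) - 1 := by ring
      ext i
      simp only [PiLp.add_apply, PiLp.smul_apply, PiLp.sub_apply, smul_eq_mul]
      field_simp
      ring
    have hyt : (p + s • (p - x)) 0 + (p + s • (p - x)) 1 = t₁ + s * (-r) := by
      simp only [PiLp.add_apply, PiLp.smul_apply, PiLp.sub_apply, smul_eq_mul, hr, hp]
      simp
      ring
    have hneg : 0 < s * r := mul_pos hs0 hr0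
    rw [hpe, hup, h.eq_profile hyS (by rw [hyt]; exact hs) (by rw [hyt]; linarith), hyt] at hc
    simp only [smul_eq_mul] at hc
    have hc' : profile a C₀ t₁ * (1 + s) ≤ profile a C₀ (t₁ + s * (-r)) + s * u x := by
      calc profile a C₀ t₁ * (1 + s)
          ≤ (1 / (1 + s) * profile a C₀ (t₁ + s * (-r)) + s / (1 + s) * u x) * (1 + s) :=
            mul_le_mul_of_nonneg_right hc h1s.le
        _ = _ := by field_simp
    rw [le_inv_mul_iff₀ hs0]
    linarith

/-- The utility has no kink along the open segment `x₁ + x₂ = t₁`: its slope on the outer side,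
along the diagonal, does not exceed the slope of the profile. -/
def NoKink (a t₁ C₀ : ℝ) (u : Plane → ℝ) : Prop :=
  ∀ p ∈ openSquare a, p 0 + p 1 = t₁ → ∀ κ > 0, ∀ᶠ s : ℝ in 𝓝[>] 0,
    u (p + s • (e₁ + e₂)) ≤ profile a C₀ t₁ + (profileDeriv a t₁ + κ) * (2 * s)

/-- The kink along the segment has the same size at all its points: since `u` is constant on the
segment, one point of the outer side that is low bounds the slope at every point of the segment. -/
lemma Ansatz.noKink_or_kink (h : Ansatz a t₀ t₁ C₀ u) (hu : Admissible (square a) u) :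
    NoKink a t₁ C₀ u ∨ ∃ κ > 0, ∀ x ∈ square a, t₁ ≤ x 0 + x 1 →
      profile a C₀ t₁ + (profileDeriv a t₁ + κ) * (x 0 + x 1 - t₁) ≤ u x := by
  by_contra! hcon
  obtain ⟨hk, hlow⟩ := hcon
  refine hk fun p hpO hp01 κ hκ => ?_
  obtain ⟨x, hx, hxt, hux⟩ := hlow κ hκ
  have hr : 0 < x 0 + x 1 - t₁ := by
    refine lt_of_le_of_ne (by linarith) fun h0 => ?_
    have := h.tangent_le hu hx
    rw [← h0] at this hux
    linarith
  set r : ℝ := x 0 + x 1 - t₁ with hr_def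
  -- `p + s (1, 1)` lies between `x` and a point `y s` of the segment
  set l : ℝ → ℝ := fun s => 2 * s / r with hl
  set y : ℝ → Plane := fun s => (1 / (1 - l s)) • (p + s • (e₁ + e₂) - l s • x) with hy
  have hl0 : l 0 = 0 := by simp [hl]
  have hy0 : y 0 = p := by simp [hy, hl0]
  have hlc : ContinuousAt l 0 := by fun_prop
  have hyc : ContinuousAt y 0 := by
    have : 1 - l 0 ≠ 0 := by simp [hl0]
    fun_prop (disch := assumption)
  have hyO : ∀ᶠ s : ℝ in 𝓝[>] 0, y s ∈ openSquare a :=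
    nhdsWithin_le_nhds (hyc.eventually ((isOpen_openSquare a).mem_nhds (by rwa [hy0])))
  have hl1 : ∀ᶠ s : ℝ in 𝓝[>] 0, l s < 1 :=
    nhdsWithin_le_nhds (hlc.eventually (gt_mem_nhds (by rw [hl0]; exact one_pos)))
  filter_upwards [hyO, hl1, self_mem_nhdsWithin] with s hsO hs1 (hs0 : 0 < s)
  have hls : 0 < l s := by positivity
  have hlr : l s * r = 2 * s := by simp only [hl]; field_simp
  have h1l : 0 < 1 - l s := by linarith
  have hyS := openSquare_subset_square a hsO
  have hcomb : (1 - l s) • y s + l s • x = p + s • (e₁ + e₂) := by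
    simp only [hy, smul_smul]
    rw [mul_one_div_cancel h1l.ne', one_smul, sub_add_cancel]
  have hyt : y s 0 + y s 1 = t₁ := by
    have e0 := congrArg (fun z : Plane => z 0 + z 1) hcomb
    simp [e₁, e₂] at e0
    have : (1 - l s) * (y s 0 + y s 1 - t₁) = 0 := by
      have hr' : x 0 + x 1 = r + t₁ := by rw [hr_def]; ring
      linear_combination e0 + hp01 - hlr - l s * hr'
    rcases mul_eq_zero.1 this with h0 | h0 <;> linarith
  have huy : u (y s) = profile a C₀ t₁ := by
    rw [h.eq_profile hyS (by rw [hyt]; exact h.middle) hyt.le, hyt]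
  have hc := hu.convexOn.2 hyS hx h1l.le hls.le (by ring)
  rw [hcomb, huy] at hc
  simp only [smul_eq_mul] at hc
  have hlux := mul_lt_mul_of_pos_left hux hls
  rw [← hlr]
  linarith

/-! ### Uniqueness in the Cauchy problem for holomorphic functions -/

/-- A holomorphic function on the square `(-ρ, ρ)²` which extends continuously to the closed square
and vanishes on its bottom side is zero: the product of its four rotations by quarter turns
vanishes on the whole boundary, hence everywhere by the maximum principle. -/
lemma eqOn_zero_of_eq_zero_bottom {G : ℂ → ℂ} {ρ : ℝ} (hρ : 0 < ρ)
    (hd : DifferentiableOn ℂ G (Ioo (-ρ) ρ ×ℂ Ioo (-ρ) ρ))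
    (hc : ContinuousOn G (Icc (-ρ) ρ ×ℂ Icc (-ρ) ρ))
    (h0 : ∀ z : ℂ, z.im = -ρ → G z = 0) :
    EqOn G 0 (Ioo (-ρ) ρ ×ℂ Ioo (-ρ) ρ) := by
  set Q : Set ℂ := Ioo (-ρ) ρ ×ℂ Ioo (-ρ) ρ with hQ
  set K : Set ℂ := Icc (-ρ) ρ ×ℂ Icc (-ρ) ρ with hK
  have hne : -ρ ≠ ρ := by linarith
  have hQo : IsOpen Q := isOpen_Ioo.reProdIm isOpen_Ioo
  have hclos : closure Q = K := by
    rw [hQ, hK, Complex.closure_reProdIm, closure_Ioo hne]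
  have hQ0 : (0 : ℂ) ∈ Q := by
    refine Complex.mem_reProdIm.2 ⟨⟨?_, ?_⟩, ?_, ?_⟩ <;> simp <;> linarith
  have rotQ : ∀ z ∈ Q, Complex.I * z ∈ Q := by
    intro z hz
    obtain ⟨⟨h1, h2⟩, h3, h4⟩ := Complex.mem_reProdIm.1 hz
    refine Complex.mem_reProdIm.2 ⟨⟨?_, ?_⟩, ?_, ?_⟩ <;> simp <;> linarith
  have rotK : ∀ z ∈ K, Complex.I * z ∈ K := by
    intro z hz
    obtain ⟨⟨h1, h2⟩, h3, h4⟩ := Complex.mem_reProdIm.1 hz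
    refine Complex.mem_reProdIm.2 ⟨⟨?_, ?_⟩, ?_, ?_⟩ <;> simp <;> linarith
  have hrot : Continuous fun z : ℂ => Complex.I * z := by fun_prop
  have hrotd : Differentiable ℂ fun z : ℂ => Complex.I * z := by fun_prop
  -- composition with a quarter turn
  have stepd : ∀ H : ℂ → ℂ, DifferentiableOn ℂ H Q →
      DifferentiableOn ℂ (fun z => H (Complex.I * z)) Q := fun H hH =>
    hH.comp hrotd.differentiableOn rotQ
  have stepc : ∀ H : ℂ → ℂ, ContinuousOn H K →
      ContinuousOn (fun z => H (Complex.I * z)) K := fun H hH =>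
    hH.comp hrot.continuousOn rotK
  set F : ℂ → ℂ := fun z => G z * G (Complex.I * z) * G (Complex.I * (Complex.I * z)) *
    G (Complex.I * (Complex.I * (Complex.I * z))) with hF
  have hFd : DifferentiableOn ℂ F Q :=
    ((hd.mul (stepd _ hd)).mul (stepd _ (stepd _ hd))).mul (stepd _ (stepd _ (stepd _ hd)))
  have hFc : ContinuousOn F (closure Q) := by
    rw [hclos]
    exact ((hc.mul (stepc _ hc)).mul (stepc _ (stepc _ hc))).mul
      (stepc _ (stepc _ (stepc _ hc)))
  have hFfr : EqOn F 0 (frontier Q) := by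
    intro z hz
    rw [hQ, Complex.frontier_reProdIm, frontier_Ioo (by linarith)] at hz
    rcases hz with hz | hz
    · obtain ⟨-, hz⟩ := Complex.mem_reProdIm.1 hz
      rcases hz with hz | hz
      · simp [hF, h0 z hz]
      · have : G (Complex.I * (Complex.I * z)) = 0 := h0 _ (by simpa using hz)
        simp [hF, this]
    · obtain ⟨hz, -⟩ := Complex.mem_reProdIm.1 hz
      rcases hz with hz | hz
      · have : G (Complex.I * z) = 0 := h0 _ (by simp [hz])
        simp [hF, this]
      · have : G (Complex.I * (Complex.I * (Complex.I * z))) = 0 := h0 _ (by simp at hz; simp [hz])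
        simp [hF, this]
  have hbdd : Bornology.IsBounded Q :=
    (Metric.isBounded_Ioo _ _).reProdIm (Metric.isBounded_Ioo _ _)
  have hF0 : EqOn F 0 Q := Complex.eqOn_of_eqOn_frontier hbdd ⟨hFd, hFc⟩
    ⟨differentiableOn_const 0, continuousOn_const⟩ hFfr
  have hGa : AnalyticOnNhd ℂ G Q := hd.analyticOnNhd hQo
  have hpre : IsPreconnected Q :=
    (((convex_Ioo (-ρ) ρ).linear_preimage Complex.reLm).inter
      ((convex_Ioo (-ρ) ρ).linear_preimage Complex.imLm)).isPreconnected
  refine hGa.eqOn_zero_of_preconnected_of_eventuallyEq_zero hpre hQ0 ?_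
  rcases (hGa 0 hQ0).eventually_eq_zero_or_eventually_ne_zero with h | h
  · exact h
  -- otherwise all four factors of `F` are nonzero near the centre
  exfalso
  have hI : Tendsto (fun z : ℂ => Complex.I * z) (𝓝[≠] 0) (𝓝[≠] 0) := by
    refine tendsto_nhdsWithin_iff.2 ⟨?_, ?_⟩
    · simpa using (hrot.tendsto 0).mono_left nhdsWithin_le_nhds
    · filter_upwards [self_mem_nhdsWithin] with z hz
      simpa using hz
  have hmem : ∀ᶠ z in 𝓝[≠] (0 : ℂ), z ∈ Q := nhdsWithin_le_nhds (hQo.mem_nhds hQ0)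
  obtain ⟨z, h1, h2, h3, h4, hz⟩ := (h.and ((hI.eventually h).and
    (((hI.comp hI).eventually h).and (((hI.comp (hI.comp hI)).eventually h).and hmem)))).exists
  exact mul_ne_zero (mul_ne_zero (mul_ne_zero h1 h2) h3) h4 (hF0 hz)

/-- A function which is holomorphic on one side of a segment and tends to zero at the segment
vanishes near the segment. -/
lemma eq_zero_of_tendsto_zero_bottom {f : ℂ → ℂ} {ρ : ℝ} (hρ : 0 < ρ)
    (hd : ∀ z : ℂ, z.re ∈ Icc (-ρ) ρ → z.im ∈ Ioc 0 (2 * ρ) → DifferentiableAt ℂ f z)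
    (h0 : ∀ x ∈ Icc (-ρ) ρ, Tendsto f (𝓝[{z : ℂ | 0 < z.im}] (x : ℂ)) (𝓝 0))
    {z : ℂ} (hre : z.re ∈ Ioo (-ρ) ρ) (him : z.im ∈ Ioo 0 (2 * ρ)) : f z = 0 := by
  classical
  set g : ℂ → ℂ := fun z => if 0 < z.im then f z else 0 with hg
  have hopen : IsOpen {z : ℂ | 0 < z.im} := isOpen_lt continuous_const Complex.continuous_im
  have hgf : ∀ z : ℂ, 0 < z.im → g =ᶠ[𝓝 z] f := by
    intro z hz
    filter_upwards [hopen.mem_nhds hz] with y (hy : 0 < y.im)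
    simp [hg, hy]
  have hgd : ∀ z : ℂ, z.re ∈ Icc (-ρ) ρ → z.im ∈ Ioc 0 (2 * ρ) → DifferentiableAt ℂ g z :=
    fun z h1 h2 => (hd z h1 h2).congr_of_eventuallyEq (hgf z h2.1)
  have hgc : ∀ x ∈ Icc (-ρ) ρ, ContinuousAt g (x : ℂ) := by
    intro x hx
    have hgx : g x = 0 := by simp [hg]
    rw [ContinuousAt, hgx, ← nhdsWithin_univ, ← compl_union_self {z : ℂ | 0 < z.im},
      nhdsWithin_union, tendsto_sup]
    constructor
    · refine tendsto_const_nhds.congr' ?_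
      filter_upwards [self_mem_nhdsWithin] with y hy
      have hy' : ¬ 0 < y.im := hy
      simp [hg, hy']
    · refine (h0 x hx).congr' ?_
      filter_upwards [self_mem_nhdsWithin] with y hy
      have hy' : 0 < y.im := hy
      simp [hg, hy']
  set G : ℂ → ℂ := fun w => g (w + ρ * Complex.I) with hG
  have hshift : ∀ w : ℂ, (w + ρ * Complex.I).re = w.re ∧ (w + ρ * Complex.I).im = w.im + ρ := by
    intro w; simp
  have key := eqOn_zero_of_eq_zero_bottom (G := G) hρ ?_ ?_ ?_
  · have hzm : z - ρ * Complex.I ∈ Ioo (-ρ) ρ ×ℂ Ioo (-ρ) ρ := by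
      refine Complex.mem_reProdIm.2 ⟨by simpa using hre, ?_, ?_⟩
      · simpa using him.1
      · simp; linarith [him.2]
    have := key hzm
    simp only [hG, sub_add_cancel, Pi.zero_apply] at this
    simpa [hg, him.1] using this
  · intro w hw
    obtain ⟨h1, h2, h3⟩ := Complex.mem_reProdIm.1 hw
    refine DifferentiableAt.differentiableWithinAt ?_
    refine DifferentiableAt.comp w (g := g) (hgd _ ?_ ?_) (by fun_prop)
    · rw [(hshift w).1]; exact Ioo_subset_Icc_self h1
    · rw [(hshift w).2]; constructor <;> linarith
  · intro w hw
    obtain ⟨h1, h2, h3⟩ := Complex.mem_reProdIm.1 hw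
    refine ContinuousAt.continuousWithinAt ?_
    refine ContinuousAt.comp (g := g) (f := fun w => w + ρ * Complex.I) ?_ (by fun_prop)
    rcases h2.eq_or_lt with h2 | h2
    · have : w + ρ * Complex.I = ((w.re : ℝ) : ℂ) := by
        apply Complex.ext <;> simp [← h2]
      rw [this]
      exact hgc _ h1
    · refine (hgd _ ?_ ?_).continuousAt
      · rw [(hshift w).1]; exact h1
      · rw [(hshift w).2]; constructor <;> linarith
  · intro w hw
    simp [hG, hg, hw]

/-! ### The gradient at the segment between the strip and the third region -/

/-- The open part of the third region. -/
def outerRegion (a t₁ : ℝ) : Set Plane := {x | x ∈ openSquare a ∧ t₁ < x 0 + x 1}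

lemma isOpen_outerRegion (a t₁ : ℝ) : IsOpen (outerRegion a t₁) :=
  (isOpen_openSquare a).inter
    (isOpen_lt continuous_const (by fun_prop : Continuous fun x : Plane => x 0 + x 1))

lemma convex_outerRegion (a t₁ : ℝ) : Convex ℝ (outerRegion a t₁) := by
  refine (convex_openSquare a).inter fun x hx y hy s t hs ht hst => ?_
  have h := convex_Ioi t₁ hx hy hs ht hst
  simp only [mem_Ioi, smul_eq_mul] at h
  change t₁ < (s • x + t • y) 0 + (s • x + t • y) 1
  simp only [PiLp.add_apply, PiLp.smul_apply, smul_eq_mul]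
  linarith

lemma outerRegion_subset_interior (a t₁ : ℝ) : outerRegion a t₁ ⊆ interior (Ω₂ a t₁) :=
  interior_maximal (fun _ hx => ⟨openSquare_subset_square a hx.1, hx.2⟩) (isOpen_outerRegion a t₁)

lemma Ansatz.contDiffAt (h : Ansatz a t₀ t₁ C₀ u) {x : Plane} (hx : x ∈ outerRegion a t₁) :
    ContDiffAt ℝ 2 u x :=
  h.contDiffOn.contDiffAt (isOpen_interior.mem_nhds (outerRegion_subset_interior a t₁ hx))

/-- The gradient inequality for convex functions. -/
lemma _root_.ConvexOn.fderiv_sub_le {E : Type*} [NormedAddCommGroup E] [NormedSpace ℝ E]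
    {S : Set E} {f : E → ℝ} (hf : ConvexOn ℝ S f) {x y : E} (hx : x ∈ S) (hy : y ∈ S)
    (hd : DifferentiableAt ℝ f x) : fderiv ℝ f x (y - x) ≤ f y - f x := by
  have h1 : HasDerivAt (fun s : ℝ => x + s • (y - x)) (y - x) 0 := by
    simpa using ((hasDerivAt_id (0 : ℝ)).smul_const (y - x)).const_add x
  have h2 : HasDerivAt (fun s : ℝ => f (x + s • (y - x))) (fderiv ℝ f x (y - x)) 0 := by
    have h3 : HasFDerivAt f (fderiv ℝ f x) (x + (0 : ℝ) • (y - x)) := by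
      simpa using hd.hasFDerivAt
    exact h3.comp_hasDerivAt (0 : ℝ) h1
  refine le_of_tendsto h2.tendsto_slope_zero_right ?_
  filter_upwards [Ioo_mem_nhdsGT (zero_lt_one' ℝ)] with s hs
  have hc := hf.2 hx hy (sub_nonneg.2 hs.2.le) hs.1.le (by ring)
  have he : (1 - s) • x + s • y = x + s • (y - x) := by module
  rw [he] at hc
  simp only [smul_eq_mul] at hc
  simp only [zero_add, zero_smul, add_zero, smul_eq_mul]
  rw [inv_mul_le_iff₀ hs.1]
  linarith

/-- Upper semicontinuity of the directional derivatives of a convex function. -/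
lemma _root_.ConvexOn.eventually_fderiv_le {E : Type*} [NormedAddCommGroup E] [NormedSpace ℝ E]
    {S V : Set E} {f : E → ℝ} (hf : ConvexOn ℝ S f) {p w : E}
    (hS : S ∈ 𝓝 p) (hVS : V ⊆ S) (hd : ∀ x ∈ V, DifferentiableAt ℝ f x)
    (hc : ∀ᶠ x in 𝓝 p, ContinuousAt f x) {d d' : ℝ} (hdd : d < d')
    (hp : ∀ᶠ s : ℝ in 𝓝[>] 0, f (p + s • w) ≤ f p + d * s) :
    ∀ᶠ x in 𝓝[V] p, fderiv ℝ f x w ≤ d' := by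
  have hline : Tendsto (fun s : ℝ => p + s • w) (𝓝[>] 0) (𝓝 p) := by
    have : ContinuousAt (fun s : ℝ => p + s • w) 0 := by fun_prop
    simpa [ContinuousAt] using this.mono_left (nhdsWithin_le_nhds (s := Ioi 0))
  obtain ⟨s, hs, hsc, hsS, hs0⟩ := (hp.and ((hline.eventually hc).and
    ((hline.eventually (eventually_mem_nhds_iff.2 hS)).and self_mem_nhdsWithin))).exists
  have hs0 : 0 < s := hs0
  have hsh : Tendsto (fun x => x + s • w) (𝓝 p) (𝓝 (p + s • w)) :=
    (continuous_id.add continuous_const).tendsto p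
  have hlim : Tendsto (fun x => f (x + s • w) - f x) (𝓝 p) (𝓝 (f (p + s • w) - f p)) :=
    (hsc.tendsto.comp hsh).sub hc.self_of_nhds.tendsto
  have hlt : f (p + s • w) - f p < d' * s := by nlinarith
  filter_upwards [nhdsWithin_le_nhds (hlim.eventually (gt_mem_nhds hlt)),
    nhdsWithin_le_nhds (hsh.eventually_mem hsS), self_mem_nhdsWithin] with x hx hxS hxV
  have := hf.fderiv_sub_le (hVS hxV) hxS (hd x hxV)
  rw [add_sub_cancel_left, map_smul, smul_eq_mul] at this
  have h2 : s * fderiv ℝ f x w < s * d' := by linarith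
  exact (lt_of_mul_lt_mul_left h2 hs0.le).le

lemma continuousAt_of_admissible (hu : Admissible (square a) u) {x : Plane}
    (hx : x ∈ openSquare a) : ContinuousAt u x :=
  hu.convexOn.continuousOn_interior.continuousAt
    (isOpen_interior.mem_nhds (openSquare_subset_interior a hx))

/-- Without a kink, the gradient of `u` tends to that of the strip utility at the segment. -/
lemma Ansatz.tendsto_fderiv (h : Ansatz a t₀ t₁ C₀ u) (hu : Admissible (square a) u)
    (hk : NoKink a t₁ C₀ u) {p : Plane} (hp : p ∈ openSquare a) (hpt : p 0 + p 1 = t₁) :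
    Tendsto (fun x => fderiv ℝ u x e₁) (𝓝[outerRegion a t₁] p) (𝓝 (profileDeriv a t₁)) ∧
    Tendsto (fun x => fderiv ℝ u x e₂) (𝓝[outerRegion a t₁] p) (𝓝 (profileDeriv a t₁)) := by
  set m := profileDeriv a t₁ with hm
  have hS : square a ∈ 𝓝 p := mem_interior_iff_mem_nhds.1 (openSquare_subset_interior a hp)
  have hVS : outerRegion a t₁ ⊆ square a := fun x hx => openSquare_subset_square a hx.1
  have hd : ∀ x ∈ outerRegion a t₁, DifferentiableAt ℝ u x := fun x hx =>
    (h.contDiffAt hx).differentiableAt (by norm_num)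
  have hc : ∀ᶠ x in 𝓝 p, ContinuousAt u x := by
    filter_upwards [(isOpen_openSquare a).mem_nhds hp] with x hx
    exact continuousAt_of_admissible hu hx
  have hup : u p = profile a C₀ t₁ := by
    rw [h.eq_profile (mem_of_mem_nhds hS) (by rw [hpt]; exact h.middle) hpt.le, hpt]
  have hline : ∀ w : Plane, ∀ᶠ s : ℝ in 𝓝[>] 0, p + s • w ∈ openSquare a ∧
      t₀ < (p + s • w) 0 + (p + s • w) 1 := by
    intro w
    have hcont : ContinuousAt (fun s : ℝ => p + s • w) 0 := by fun_prop
    have ho : IsOpen {x : Plane | x ∈ openSquare a ∧ t₀ < x 0 + x 1} := isOpen_outerRegion a t₀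
    refine nhdsWithin_le_nhds (hcont.eventually (ho.mem_nhds ?_))
    simp only [zero_smul, add_zero]
    exact ⟨hp, by rw [hpt]; exact h.middle⟩
  have key : ∀ w : Plane, ∀ d d' : ℝ, d < d' →
      (∀ᶠ s : ℝ in 𝓝[>] 0, u (p + s • w) ≤ u p + d * s) →
      ∀ᶠ x in 𝓝[outerRegion a t₁] p, fderiv ℝ u x w ≤ d' := fun w d d' hdd hpw =>
    hu.convexOn.eventually_fderiv_le hS hVS hd hc hdd hpw
  -- outwards
  have b1 : ∀ ε > 0, ∀ᶠ x in 𝓝[outerRegion a t₁] p, fderiv ℝ u x (e₁ + e₂) ≤ 2 * m + ε := by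
    intro ε hε
    refine key _ (2 * m + ε / 2) _ (by linarith) ?_
    filter_upwards [hk p hp hpt (ε / 4) (by positivity)] with s hs
    rw [hup]
    linarith
  -- inwards
  have b2 : ∀ ε > 0, ∀ᶠ x in 𝓝[outerRegion a t₁] p, fderiv ℝ u x (-(e₁ + e₂)) ≤ -(2 * m) + ε := by
    intro ε hε
    refine key _ (-(2 * m) + ε / 2) _ (by linarith) ?_
    have hder : HasDerivAt (fun s : ℝ => profile a C₀ (t₁ + s * (-2))) (m * (-2)) 0 := by
      have h1 : HasDerivAt (fun s : ℝ => t₁ + s * (-2)) (-2) 0 := by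
        simpa using ((hasDerivAt_id (0 : ℝ)).mul_const (-2 : ℝ)).const_add t₁
      have h3 : HasDerivAt (profile a C₀) m (t₁ + 0 * (-2)) := by
        simpa using hasDerivAt_profile C₀ h.two_mul_lt
      exact h3.comp (0 : ℝ) h1
    have hq := hder.tendsto_slope_zero_right.eventually
      (gt_mem_nhds (show m * (-2) < -(2 * m) + ε / 2 by linarith))
    filter_upwards [hq, hline (-(e₁ + e₂)), self_mem_nhdsWithin] with s hs hsl (hs0 : 0 < s)
    have ht : (p + s • (-(e₁ + e₂))) 0 + (p + s • (-(e₁ + e₂))) 1 = t₁ + s * (-2) := by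
      simp [e₁, e₂]
      linarith
    rw [h.eq_profile (openSquare_subset_square a hsl.1) hsl.2 (by rw [ht]; linarith), ht, hup]
    simp only [zero_add, zero_mul, add_zero, smul_eq_mul] at hs
    rw [inv_mul_lt_iff₀ hs0] at hs
    linarith
  -- along the segment
  have b3 : ∀ w : Plane, w 0 + w 1 = 0 → ∀ ε > 0,
      ∀ᶠ x in 𝓝[outerRegion a t₁] p, fderiv ℝ u x w ≤ ε := by
    intro w hw ε hε
    refine key _ 0 _ hε ?_
    filter_upwards [hline w] with s hsl
    have ht : (p + s • w) 0 + (p + s • w) 1 = t₁ := by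
      simp only [PiLp.add_apply, PiLp.smul_apply, smul_eq_mul]
      linear_combination hpt + s * hw
    rw [h.eq_profile (openSquare_subset_square a hsl.1) hsl.2 ht.le, ht, hup]
    linarith
  have lim1 : Tendsto (fun x => fderiv ℝ u x (e₁ + e₂)) (𝓝[outerRegion a t₁] p) (𝓝 (2 * m)) := by
    rw [Metric.tendsto_nhds]
    intro ε hε
    filter_upwards [b1 (ε / 2) (by positivity), b2 (ε / 2) (by positivity)] with x h1 h2
    rw [map_neg] at h2
    rw [Real.dist_eq, abs_lt]
    constructor <;> linarith
  have lim2 : Tendsto (fun x => fderiv ℝ u x (e₁ - e₂)) (𝓝[outerRegion a t₁] p) (𝓝 0) := by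
    rw [Metric.tendsto_nhds]
    intro ε hε
    filter_upwards [b3 (e₁ - e₂) (by simp [e₁, e₂]) (ε / 2) (by positivity),
      b3 (-(e₁ - e₂)) (by simp [e₁, e₂]) (ε / 2) (by positivity)] with x h1 h2
    rw [map_neg] at h2
    rw [Real.dist_eq, abs_lt]
    constructor <;> linarith
  constructor
  · have := (lim1.add lim2).const_mul (1 / 2 : ℝ)
    refine (this.congr fun x => ?_).trans (le_of_eq ?_)
    · rw [map_add, map_sub]; ring
    · congr 1; ring
  · have := (lim1.sub lim2).const_mul (1 / 2 : ℝ)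
    refine (this.congr fun x => ?_).trans (le_of_eq ?_)
    · rw [map_add, map_sub]; ring
    · congr 1; ring

/-! ### Overdetermination of the problem in the third region -/

/-- The isometry `z ↦ (Re z, Im z)`. -/
def ofComplex : ℂ ≃ₗᵢ[ℝ] Plane := Complex.orthonormalBasisOneI.repr

@[simp] lemma ofComplex_apply_zero (z : ℂ) : ofComplex z 0 = z.re := by
  simp [ofComplex]

@[simp] lemma ofComplex_apply_one (z : ℂ) : ofComplex z 1 = z.im := by
  simp [ofComplex]

lemma ofComplex_one : ofComplex 1 = e₁ := by
  ext i; fin_cases i <;> simp [e₁]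

lemma ofComplex_I : ofComplex Complex.I = e₂ := by
  ext i; fin_cases i <;> simp [e₂]

lemma fderiv_comp_ofComplex (f : Plane → ℝ) (z : ℂ) :
    fderiv ℝ (fun z => f (ofComplex z)) z = (fderiv ℝ f (ofComplex z)).comp
      (ofComplex.toContinuousLinearEquiv : ℂ →L[ℝ] Plane) :=
  ofComplex.toContinuousLinearEquiv.comp_right_fderiv (f := f) (x := z)

lemma laplacian_comp_ofComplex (f : Plane → ℝ) (z : ℂ) :
    Laplacian.laplacian (fun z => f (ofComplex z)) z = Laplacian.laplacian f (ofComplex z) := by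
  rw [laplacian_eq_iteratedFDeriv_complexPlane,
    laplacian_eq_iteratedFDeriv_orthonormalBasis f (EuclideanSpace.basisFun (Fin 2) ℝ)]
  have hD : iteratedFDeriv ℝ 2 (fun z => f (ofComplex z)) z =
      (iteratedFDeriv ℝ 2 f (ofComplex z)).compContinuousLinearMap
        fun _ => (ofComplex.toContinuousLinearEquiv : ℂ →L[ℝ] Plane) := by
    have := ofComplex.toContinuousLinearEquiv.iteratedFDerivWithin_comp_right (i := 2) f
      uniqueDiffOn_univ (x := z) (mem_univ _)
    simp only [preimage_univ, iteratedFDerivWithin_univ] at this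
    exact this
  beta_reduce
  rw [hD]
  simp only [Fin.sum_univ_two, ContinuousMultilinearMap.compContinuousLinearMap_apply]
  congr 2 <;> ext i j <;> fin_cases i <;> fin_cases j <;> simp

/-- A function of `x₁ + x₂` with the Laplacian of `u`, the slope of `u` at the segment, and the
value `0` there. -/
def cauchySolution (m t₁ : ℝ) (z : ℂ) : ℝ :=
  3 / 4 * (z.re + z.im - t₁) ^ 2 + m * (z.re + z.im - t₁)

lemma hasFDerivAt_cauchySolution (m t₁ : ℝ) (z : ℂ) :
    HasFDerivAt (cauchySolution m t₁)
      ((3 / 2 * (z.re + z.im - t₁) + m) • (Complex.reCLM + Complex.imCLM)) z := by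
  have h1 : HasFDerivAt (fun z : ℂ => z.re + z.im - t₁) (Complex.reCLM + Complex.imCLM) z :=
    (Complex.reCLM.hasFDerivAt.add Complex.imCLM.hasFDerivAt).sub_const t₁
  refine (((h1.pow 2).const_mul (3 / 4 : ℝ)).add (h1.const_mul m)).congr_fderiv ?_
  ext
  simp
  ring

lemma contDiff_cauchySolution (m t₁ : ℝ) : ContDiff ℝ 2 (cauchySolution m t₁) := by
  have h1 : ContDiff ℝ 2 fun z : ℂ => z.re + z.im - t₁ :=
    (Complex.reCLM.contDiff.add Complex.imCLM.contDiff).sub contDiff_const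
  exact (contDiff_const.mul (h1.pow 2)).add (contDiff_const.mul h1)

lemma laplacian_cauchySolution (m t₁ : ℝ) (z : ℂ) :
    Laplacian.laplacian (cauchySolution m t₁) z = 3 := by
  have h1 : HasFDerivAt (fun z : ℂ => z.re + z.im - t₁) (Complex.reCLM + Complex.imCLM) z :=
    (Complex.reCLM.hasFDerivAt.add Complex.imCLM.hasFDerivAt).sub_const t₁
  have h2 := ((h1.const_mul (3 / 2 : ℝ)).add_const m).smul_const (Complex.reCLM + Complex.imCLM)
  have h3 : fderiv ℝ (cauchySolution m t₁) =
      fun z => (3 / 2 * (z.re + z.im - t₁) + m) • (Complex.reCLM + Complex.imCLM) :=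
    funext fun z => (hasFDerivAt_cauchySolution m t₁ z).fderiv
  simp only [laplacian_eq_iteratedFDeriv_complexPlane, iteratedFDeriv_two_apply, h3, h2.fderiv]
  simp

/-- Where the gradient of `u` matches that of the strip utility along the segment, `u` has the
gradient of the one-dimensional solution: the complex gradient of the difference is holomorphic
and tends to zero at the segment. -/
lemma Ansatz.fderiv_eq (h : Ansatz a t₀ t₁ C₀ u) (hu : Admissible (square a) u)
    (hk : NoKink a t₁ C₀ u) {x : Plane} (hx : x ∈ outerRegion a t₁) :
    fderiv ℝ u x e₁ = 3 / 2 * (x 0 + x 1 - t₁) + profileDeriv a t₁ := by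
  set m := profileDeriv a t₁ with hm
  set w : ℂ → ℝ := (fun z => u (ofComplex z)) - cauchySolution m t₁ with hw
  set f : ℂ → ℂ := fun z => fderiv ℝ w z 1 - Complex.I * fderiv ℝ w z Complex.I with hf
  set V : Set ℂ := ofComplex ⁻¹' outerRegion a t₁ with hV
  have hVo : IsOpen V := (isOpen_outerRegion a t₁).preimage ofComplex.continuous
  have hcd : ∀ z ∈ V, ContDiffAt ℝ 2 (fun z => u (ofComplex z)) z := fun z hz =>
    (h.contDiffAt hz).comp z ofComplex.contDiff.contDiffAt
  have hharm : ∀ z ∈ V, HarmonicAt w z := by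
    intro z hz
    refine ⟨(hcd z hz).sub (contDiff_cauchySolution m t₁).contDiffAt, ?_⟩
    filter_upwards [hVo.mem_nhds hz] with y hy
    rw [hw, (hcd y hy).laplacian_sub (contDiff_cauchySolution m t₁).contDiffAt,
      laplacian_comp_ofComplex, laplacian_cauchySolution,
      h.poisson _ (outerRegion_subset_interior a t₁ hy)]
    simp
  have hfd : ∀ z ∈ V, DifferentiableAt ℂ f z := fun z hz =>
    HarmonicAt.differentiableAt_complex_partial (hharm z hz)
  have hwd : ∀ z ∈ V, ∀ v : ℂ, fderiv ℝ w z v = fderiv ℝ u (ofComplex z) (ofComplex v) -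
      (3 / 2 * (z.re + z.im - t₁) + m) * (v.re + v.im) := by
    intro z hz v
    have h1 : DifferentiableAt ℝ (fun z => u (ofComplex z)) z :=
      (hcd z hz).differentiableAt (by norm_num)
    rw [hw, fderiv_sub h1 (hasFDerivAt_cauchySolution m t₁ z).differentiableAt,
      (hasFDerivAt_cauchySolution m t₁ z).fderiv, fderiv_comp_ofComplex]
    simp
    ring
  -- the segment is the image of a real interval, with `1 + i` as the inner normal
  set ψ : ℂ → ℂ := fun ζ => t₁ / 2 * (1 + Complex.I) + (1 - Complex.I) * ζ with hψ
  have hψre : ∀ ζ, (ψ ζ).re = t₁ / 2 + ζ.re + ζ.im := by intro ζ; simp [hψ]; ring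
  have hψim : ∀ ζ, (ψ ζ).im = t₁ / 2 - ζ.re + ζ.im := by intro ζ; simp [hψ]; ring
  have hψd : Differentiable ℂ ψ := by fun_prop
  have ha1 := h.two_mul_lt
  have ha2 := h.upper
  obtain ⟨ρ, hρ, hρ1, hρ2⟩ : ∃ ρ : ℝ, 0 < ρ ∧ 3 * ρ < t₁ / 2 - a ∧ 3 * ρ < a + 1 - t₁ / 2 := by
    refine ⟨min (t₁ / 2 - a) (a + 1 - t₁ / 2) / 4, ?_, ?_, ?_⟩
    · have : 0 < min (t₁ / 2 - a) (a + 1 - t₁ / 2) := lt_min (by linarith) (by linarith)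
      positivity
    · have := min_le_left (t₁ / 2 - a) (a + 1 - t₁ / 2)
      linarith
    · have := min_le_right (t₁ / 2 - a) (a + 1 - t₁ / 2)
      linarith
  have hsq : ∀ ζ : ℂ, ζ.re ∈ Icc (-ρ) ρ → ζ.im ∈ Icc 0 (2 * ρ) →
      ofComplex (ψ ζ) ∈ openSquare a := by
    intro ζ h1 h2
    constructor
    · rw [ofComplex_apply_zero, hψre]
      constructor <;> linarith [h1.1, h1.2, h2.1, h2.2]
    · rw [ofComplex_apply_one, hψim]
      constructor <;> linarith [h1.1, h1.2, h2.1, h2.2]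
  have hsum : ∀ ζ : ℂ, ofComplex (ψ ζ) 0 + ofComplex (ψ ζ) 1 = t₁ + 2 * ζ.im := by
    intro ζ
    rw [ofComplex_apply_zero, ofComplex_apply_one, hψre, hψim]
    ring
  have hψV : ∀ ζ : ℂ, ζ.re ∈ Icc (-ρ) ρ → ζ.im ∈ Ioc 0 (2 * ρ) → ψ ζ ∈ V := by
    intro ζ h1 h2
    exact ⟨hsq ζ h1 (Ioc_subset_Icc_self h2), by rw [hsum]; linarith [h2.1]⟩
  have hlim : ∀ s ∈ Icc (-ρ) ρ,
      Tendsto (fun ζ => f (ψ ζ)) (𝓝[{z : ℂ | 0 < z.im}] (s : ℂ)) (𝓝 0) := by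
    intro s hs
    have hp : ofComplex (ψ s) ∈ openSquare a :=
      hsq s (by simpa using hs) (by simp [hρ.le])
    have hpt : ofComplex (ψ s) 0 + ofComplex (ψ s) 1 = t₁ := by rw [hsum]; simp
    have hcont : ContinuousAt (fun ζ => ofComplex (ψ ζ)) (s : ℂ) :=
      (ofComplex.continuous.comp hψd.continuous).continuousAt
    have hto : Tendsto (fun ζ => ofComplex (ψ ζ)) (𝓝[{z : ℂ | 0 < z.im}] (s : ℂ))
        (𝓝[outerRegion a t₁] (ofComplex (ψ s))) := by
      refine tendsto_nhdsWithin_iff.2 ⟨hcont.mono_left nhdsWithin_le_nhds, ?_⟩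
      filter_upwards [nhdsWithin_le_nhds (hcont.eventually ((isOpen_openSquare a).mem_nhds hp)),
        self_mem_nhdsWithin] with ζ h1 h2
      have h2 : 0 < ζ.im := h2
      exact ⟨h1, by rw [hsum]; linarith⟩
    obtain ⟨l1, l2⟩ := h.tendsto_fderiv hu hk hp hpt
    have hr : Tendsto (fun ζ : ℂ => 3 / 2 * (2 * ζ.im) + m) (𝓝[{z : ℂ | 0 < z.im}] (s : ℂ))
        (𝓝 m) := by
      have : Continuous fun ζ : ℂ => 3 / 2 * (2 * ζ.im) + m := by fun_prop
      simpa using (this.tendsto (s : ℂ)).mono_left nhdsWithin_le_nhds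
    have d1 : Tendsto (fun ζ => ((fderiv ℝ u (ofComplex (ψ ζ)) e₁ - (3 / 2 * (2 * ζ.im) + m) : ℝ) :
        ℂ)) (𝓝[{z : ℂ | 0 < z.im}] (s : ℂ)) (𝓝 0) := by
      have h0 := (l1.comp hto).sub hr
      rw [sub_self] at h0
      exact (Complex.continuous_ofReal.tendsto' 0 0 Complex.ofReal_zero).comp h0
    have d2 : Tendsto (fun ζ => ((fderiv ℝ u (ofComplex (ψ ζ)) e₂ - (3 / 2 * (2 * ζ.im) + m) : ℝ) :
        ℂ)) (𝓝[{z : ℂ | 0 < z.im}] (s : ℂ)) (𝓝 0) := by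
      have h0 := (l2.comp hto).sub hr
      rw [sub_self] at h0
      exact (Complex.continuous_ofReal.tendsto' 0 0 Complex.ofReal_zero).comp h0
    have d3 := d1.sub (d2.const_mul Complex.I)
    rw [mul_zero, sub_zero] at d3
    refine d3.congr' ?_
    filter_upwards [hto.eventually_mem self_mem_nhdsWithin] with ζ hζ
    have hz : ψ ζ ∈ V := hζ
    have hsum' := hsum ζ
    rw [ofComplex_apply_zero, ofComplex_apply_one] at hsum'
    simp only [hf]
    rw [hwd _ hz, hwd _ hz, ofComplex_one, ofComplex_I, hsum']
    simp
  have hzero : ∀ ζ : ℂ, ζ.re ∈ Ioo (-ρ) ρ → ζ.im ∈ Ioo 0 (2 * ρ) → f (ψ ζ) = 0 :=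
    fun ζ h1 h2 => eq_zero_of_tendsto_zero_bottom (f := fun ζ => f (ψ ζ)) hρ
      (fun z hz1 hz2 => (hfd _ (hψV z hz1 hz2)).comp z hψd.differentiableAt) hlim h1 h2
  have hfa : AnalyticOnNhd ℂ f V :=
    DifferentiableOn.analyticOnNhd (fun z hz => (hfd z hz).differentiableWithinAt) hVo
  have hpre : IsPreconnected V :=
    ((convex_outerRegion a t₁).linear_preimage
      (ofComplex.toLinearEquiv : ℂ →ₗ[ℝ] Plane)).isPreconnected
  set ζ₀ : ℂ := ρ * Complex.I with hζ₀
  have hζV : ψ ζ₀ ∈ V := hψV ζ₀ (by simp [hζ₀, hρ.le]) (by simp [hζ₀, hρ])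
  have hnear : f =ᶠ[𝓝 (ψ ζ₀)] 0 := by
    set χ : ℂ → ℂ := fun z => (1 - Complex.I)⁻¹ * (z - t₁ / 2 * (1 + Complex.I)) with hχ
    have hI : (1 - Complex.I) ≠ 0 := by
      intro h0
      have := congrArg Complex.re h0
      simp at this
    have hψχ : ∀ z, ψ (χ z) = z := by
      intro z
      simp only [hψ, hχ]
      rw [mul_inv_cancel_left₀ hI]
      ring
    have hχψ : χ (ψ ζ₀) = ζ₀ := by
      simp only [hψ, hχ]
      rw [add_sub_cancel_left, inv_mul_cancel_left₀ hI]
    have hχc : ContinuousAt χ (ψ ζ₀) := by fun_prop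
    have hre : ∀ᶠ z in 𝓝 (ψ ζ₀), (χ z).re ∈ Ioo (-ρ) ρ :=
      (Complex.continuous_re.continuousAt.comp hχc).eventually
        (isOpen_Ioo.mem_nhds
          (by rw [Function.comp_apply, hχψ]; simp [hζ₀, hρ]))
    have him : ∀ᶠ z in 𝓝 (ψ ζ₀), (χ z).im ∈ Ioo 0 (2 * ρ) :=
      (Complex.continuous_im.continuousAt.comp hχc).eventually
        (isOpen_Ioo.mem_nhds
          (by rw [Function.comp_apply, hχψ]; simp [hζ₀, hρ]))
    filter_upwards [hre, him] with z h1 h2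
    rw [← hψχ z]
    exact hzero _ h1 h2
  have hf0 := hfa.eqOn_zero_of_preconnected_of_eventuallyEq_zero hpre hζV hnear
  obtain ⟨z, rfl⟩ := ofComplex.surjective x
  have hz : z ∈ V := hx
  have h0 := congrArg Complex.re (hf0 hz)
  simp only [hf, Pi.zero_apply, Complex.sub_re, Complex.mul_re, Complex.I_re, Complex.I_im,
    Complex.ofReal_re, Complex.ofReal_im, Complex.zero_re] at h0
  rw [hwd z hz, ofComplex_one] at h0
  simp only [ofComplex_apply_zero, ofComplex_apply_one]
  simp at h0
  linarith

/-- Without a kink the problem in the third region is overdetermined: on the right edge of the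
square the normal derivative of `u` is not constant, against the Neumann condition. -/
theorem Ansatz.not_noKink (h : Ansatz a t₀ t₁ C₀ u) (hu : Admissible (square a) u) :
    ¬ NoKink a t₁ C₀ u := by
  intro hk
  set m := profileDeriv a t₁ with hm
  have key : ∀ y ∈ Ioo a (a + 1), t₁ < a + 1 + y → 3 / 2 * (a + 1 + y - t₁) + m = a + 1 := by
    intro y hy hyt
    set x : Plane := !₂[a + 1, y] with hx
    have hxS : x ∈ Ω₂ a t₁ := by
      refine ⟨⟨?_, ?_⟩, ?_⟩
      · simp [hx]
      · simpa [hx] using Ioo_subset_Icc_self hy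
      · simpa [hx] using hyt
    have hN := h.neumann_right x hxS (by simp [hx]) (by simpa [hx] using hy)
    have hin : inner ℝ x e₁ = a + 1 := by
      simp [hx, e₁, PiLp.inner_apply, Fin.sum_univ_two]
    rw [hin] at hN
    obtain ⟨δ, hδ, hδ1, hδ2⟩ : ∃ δ : ℝ, 0 < δ ∧ δ < 1 ∧ t₁ < a + 1 + y - δ := by
      refine ⟨min (1 / 2) ((a + 1 + y - t₁) / 2), lt_min (by norm_num) (by linarith), ?_, ?_⟩
      · linarith [min_le_left (1 / 2) ((a + 1 + y - t₁) / 2)]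
      · linarith [min_le_right (1 / 2) ((a + 1 + y - t₁) / 2)]
    have hO : ∀ s ∈ Ioo (-δ) 0, x + s • e₁ ∈ outerRegion a t₁ := by
      intro s hs
      refine ⟨⟨?_, ?_⟩, ?_⟩
      · simp only [hx, e₁]; simp; constructor <;> linarith [hs.1, hs.2]
      · simpa [hx, e₁] using hy
      · simp only [hx, e₁]; simp; linarith [hs.1]
    have hder : ∀ s ∈ Ioo (-δ) 0, HasDerivAt (fun s : ℝ => u (x + s • e₁))
        (3 / 2 * (a + 1 + s + y - t₁) + m) s := by
      intro s hs
      have h1 : HasDerivAt (fun s : ℝ => x + s • e₁) e₁ s := by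
        simpa using ((hasDerivAt_id s).smul_const e₁).const_add x
      have h2 := ((h.contDiffAt (hO s hs)).differentiableAt (by norm_num)).hasFDerivAt
      have h3 := h2.comp_hasDerivAt s h1
      rw [h.fderiv_eq hu hk (hO s hs)] at h3
      refine h3.congr_deriv ?_
      simp [hx, e₁, hm]
    have hs : Ioo (-δ) 0 ∈ 𝓝[<] (0 : ℝ) := Ioo_mem_nhdsLT (by linarith)
    have hleft : HasDerivWithinAt (fun s : ℝ => u (x + s • e₁))
        (3 / 2 * (a + 1 + y - t₁) + m) (Iic 0) 0 := by
      refine hasDerivWithinAt_Iic_of_tendsto_deriv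
        (fun s hs => (hder s hs).differentiableAt.differentiableWithinAt)
        (hN.continuousWithinAt.mono fun s hs => hs.2.le) hs ?_
      have hc : Continuous fun s : ℝ => 3 / 2 * (a + 1 + s + y - t₁) + m := by fun_prop
      have hc0 : Tendsto (fun s : ℝ => 3 / 2 * (a + 1 + s + y - t₁) + m) (𝓝[<] 0)
          (𝓝 (3 / 2 * (a + 1 + y - t₁) + m)) := by
        simpa using (hc.tendsto 0).mono_left nhdsWithin_le_nhds
      refine hc0.congr' ?_
      filter_upwards [hs] with s hs
      exact (hder s hs).deriv.symm
    exact (uniqueDiffOn_Iic (0 : ℝ) 0 self_mem_Iic).eq_deriv _ hleft hN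
  have hup := h.upper
  set b := max a (t₁ - a - 1) with hb
  have hb1 : a ≤ b := le_max_left _ _
  have hb2 : t₁ - a - 1 ≤ b := le_max_right _ _
  have hb3 : b < a + 1 := max_lt (by linarith) (by linarith)
  have k1 := key ((b + (a + 1)) / 2) ⟨by linarith, by linarith⟩ (by linarith)
  have k2 := key ((b + 3 * (a + 1)) / 4) ⟨by linarith, by linarith⟩ (by linarith)
  linarith

/-- Continuous differentiability excludes the kink. -/
lemma Ansatz.noKink_of_contDiffOn (h : Ansatz a t₀ t₁ C₀ u)
    (hC : ContDiffOn ℝ 1 u (square a)) : NoKink a t₁ C₀ u := by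
  intro p hp hpt κ hκ
  set m := profileDeriv a t₁ with hm
  have hS : square a ∈ 𝓝 p := mem_interior_iff_mem_nhds.1 (openSquare_subset_interior a hp)
  have hd : DifferentiableAt ℝ u p := (hC.contDiffAt hS).differentiableAt (by norm_num)
  have hline : HasDerivAt (fun s : ℝ => p + s • (e₁ + e₂)) (e₁ + e₂) 0 := by
    simpa using ((hasDerivAt_id (0 : ℝ)).smul_const (e₁ + e₂)).const_add p
  have hD : HasDerivAt (fun s : ℝ => u (p + s • (e₁ + e₂))) (fderiv ℝ u p (e₁ + e₂)) 0 := by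
    have h3 : HasFDerivAt u (fderiv ℝ u p) (p + (0 : ℝ) • (e₁ + e₂)) := by
      simpa using hd.hasFDerivAt
    exact h3.comp_hasDerivAt (0 : ℝ) hline
  have ht : ∀ s : ℝ, (p + s • (e₁ + e₂)) 0 + (p + s • (e₁ + e₂)) 1 = t₁ + s * 2 := by
    intro s
    simp [e₁, e₂]
    linarith
  have hU : HasDerivAt (fun s : ℝ => profile a C₀ (t₁ + s * 2)) (m * 2) 0 := by
    have h1 : HasDerivAt (fun s : ℝ => t₁ + s * 2) 2 0 := by
      simpa using ((hasDerivAt_id (0 : ℝ)).mul_const (2 : ℝ)).const_add t₁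
    have h3 : HasDerivAt (profile a C₀) m (t₁ + 0 * 2) := by
      simpa using hasDerivAt_profile C₀ h.two_mul_lt
    exact h3.comp (0 : ℝ) h1
  have hnear : ∀ᶠ s : ℝ in 𝓝 0, p + s • (e₁ + e₂) ∈ outerRegion a t₀ := by
    refine hline.continuousAt.eventually ((isOpen_outerRegion a t₀).mem_nhds ?_)
    simp only [zero_smul, add_zero]
    exact ⟨hp, by rw [hpt]; exact h.middle⟩
  have hval : ∀ᶠ s : ℝ in 𝓝[≤] 0, u (p + s • (e₁ + e₂)) = profile a C₀ (t₁ + s * 2) := by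
    filter_upwards [nhdsWithin_le_nhds hnear, self_mem_nhdsWithin] with s hs (hs0 : s ≤ 0)
    rw [h.eq_profile (openSquare_subset_square a hs.1) hs.2 (by rw [ht]; linarith), ht]
  have hL : fderiv ℝ u p (e₁ + e₂) = m * 2 :=
    (uniqueDiffOn_Iic (0 : ℝ) 0 self_mem_Iic).eq_deriv _ hD.hasDerivWithinAt
      (hU.hasDerivWithinAt.congr_of_eventuallyEq_of_mem hval self_mem_Iic)
  have hup : u p = profile a C₀ t₁ := by
    simpa using hval.self_of_nhdsWithin self_mem_Iic
  rw [hL] at hD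
  filter_upwards [hD.tendsto_slope_zero_right.eventually
    (gt_mem_nhds (show m * 2 < m * 2 + 2 * κ by linarith)), self_mem_nhdsWithin] with s hs hs0
  have hs0 : 0 < s := hs0
  simp only [zero_add, zero_smul, add_zero, smul_eq_mul] at hs
  rw [inv_mul_lt_iff₀ hs0, hup] at hs
  linarith

/-! ### Integration by parts on lines -/

/-- Integration by parts against `x - k` for a function with values in `[0, ε]` whose support has
length at most `2ρ`: the boundary terms only appear if the support comes near the endpoints. -/
lemma integral_deriv_slice_ge {a b k ε τ ρ M : ℝ} {h : ℝ → ℝ} (hab : a < b) (hρ : 0 < ρ)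
    (hlip : LocallyLipschitzOn (Ioo a b) h)
    (h0 : ∀ x ∈ Ioo a b, 0 ≤ h x) (hε : ∀ x ∈ Ioo a b, h x ≤ ε)
    (hsupp : ∀ x ∈ Ioo a b, h x ≠ 0 → |x - τ| < ρ)
    (hM : ∀ x ∈ Ioo a b, |x - k| ≤ M)
    (hint : IntegrableOn (fun x => (x - k) * deriv h x - h x) (Ioo a b)) :
    -(M * ε * ((Ioo (a - 2 * ρ) (a + 2 * ρ)).indicator 1 τ +
      (Ioo (b - 2 * ρ) (b + 2 * ρ)).indicator 1 τ) + 4 * ρ * ε) ≤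
    ∫ x in Ioo a b, ((x - k) * deriv h x - h x) := by
  have hmid : (a + b) / 2 ∈ Ioo a b := ⟨by linarith, by linarith⟩
  have hε0 : 0 ≤ ε := (h0 _ hmid).trans (hε _ hmid)
  have hM0 : 0 ≤ M := (abs_nonneg _).trans (hM _ hmid)
  have hA : Tendsto (fun s : ℝ => a + s) (𝓝[>] 0) (𝓝 a) := by
    have : Continuous fun s : ℝ => a + s := by fun_prop
    simpa using (this.tendsto 0).mono_left nhdsWithin_le_nhds
  have hB : Tendsto (fun s : ℝ => b - s) (𝓝[>] 0) (𝓝 b) := by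
    have : Continuous fun s : ℝ => b - s := by fun_prop
    simpa using (this.tendsto 0).mono_left nhdsWithin_le_nhds
  have hcov := aecover_Ioo_of_Icc (μ := (volume : Measure ℝ)) hA hB
  refine ge_of_tendsto (hcov.integral_tendsto_of_countably_generated hint) ?_
  have hmin : 0 < min ρ ((b - a) / 2) := lt_min hρ (by linarith)
  filter_upwards [Ioo_mem_nhdsGT hmin] with s hs
  have hsρ : s < ρ := hs.2.trans_le (min_le_left _ _)
  have hsab : s < (b - a) / 2 := hs.2.trans_le (min_le_right _ _)
  have hs0 := hs.1
  have hsub : Icc (a + s) (b - s) ⊆ Ioo a b := fun x hx =>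
    ⟨by linarith [hx.1], by linarith [hx.2]⟩
  have hle : a + s ≤ b - s := by linarith
  have hAm : a + s ∈ Ioo a b := hsub ⟨le_rfl, hle⟩
  have hBm : b - s ∈ Ioo a b := hsub ⟨hle, le_rfl⟩
  obtain ⟨K, hK⟩ := (hlip.mono hsub).exists_lipschitzOnWith_of_compact isCompact_Icc
  have hac : AbsolutelyContinuousOnInterval h (a + s) (b - s) :=
    LipschitzOnWith.absolutelyContinuousOnInterval (by rwa [uIcc_of_le hle])
  have hid : AbsolutelyContinuousOnInterval (fun x : ℝ => x - k) (a + s) (b - s) :=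
    LipschitzOnWith.absolutelyContinuousOnInterval
      (K := 1) (LipschitzWith.of_dist_le_mul (by simp)).lipschitzOnWith
  have hparts := hid.integral_mul_deriv_eq_deriv_mul hac
  have hcont : ContinuousOn h (uIcc (a + s) (b - s)) := by
    rw [uIcc_of_le hle]; exact hK.continuousOn
  have hhint : IntervalIntegrable h volume (a + s) (b - s) := hcont.intervalIntegrable
  have hdint : IntervalIntegrable (fun x => (x - k) * deriv h x) volume (a + s) (b - s) :=
    hac.intervalIntegrable_deriv.continuousOn_mul (by fun_prop)
  rw [Measure.restrict_restrict measurableSet_Icc, inter_eq_left.2 hsub,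
    integral_Icc_eq_integral_Ioc, ← intervalIntegral.integral_of_le hle,
    intervalIntegral.integral_sub hdint hhint, hparts]
  have hderiv : ∀ x : ℝ, deriv (fun x : ℝ => x - k) x = 1 := fun x => by simp
  simp only [hderiv, one_mul]
  -- the integral of `h`
  have hI : ∫ x in (a + s)..(b - s), h x ≤ 2 * ρ * ε := by
    have hind : IntervalIntegrable ((Ioo (τ - ρ) (τ + ρ)).indicator fun _ => ε) volume
        (a + s) (b - s) :=
      (((integrable_indicator_iff measurableSet_Ioo).2
        (by simp)).intervalIntegrable)
    have h1 : ∫ x in (a + s)..(b - s), h x ≤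
        ∫ x in (a + s)..(b - s), (Ioo (τ - ρ) (τ + ρ)).indicator (fun _ => ε) x := by
      refine intervalIntegral.integral_mono_on hle hhint hind fun x hx => ?_
      by_cases hx0 : h x = 0
      · rw [hx0]
        exact indicator_nonneg (fun _ _ => hε0) x
      · have hxτ := abs_lt.1 (hsupp x (hsub hx) hx0)
        rw [indicator_of_mem (show x ∈ Ioo (τ - ρ) (τ + ρ) from
          ⟨by linarith [hxτ.1], by linarith [hxτ.2]⟩)]
        exact hε x (hsub hx)
    have h2 : ∫ x in (a + s)..(b - s), (Ioo (τ - ρ) (τ + ρ)).indicator (fun _ => ε) x ≤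
        ∫ x, (Ioo (τ - ρ) (τ + ρ)).indicator (fun _ => ε) x := by
      rw [intervalIntegral.integral_of_le hle]
      exact setIntegral_le_integral ((integrable_indicator_iff measurableSet_Ioo).2 (by simp))
        (ae_of_all _ fun x => indicator_nonneg (fun _ _ => hε0) x)
    have h3 : ∫ x, (Ioo (τ - ρ) (τ + ρ)).indicator (fun _ => ε) x = 2 * ρ * ε := by
      rw [integral_indicator measurableSet_Ioo, setIntegral_const, Real.volume_real_Ioo_of_le
        (by linarith), smul_eq_mul]
      ring
    linarith
  -- the boundary terms
  have hbd : ∀ c x : ℝ, x ∈ Ioo a b → |x - c| ≤ s →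
      |(x - k) * h x| ≤ M * ε * (Ioo (c - 2 * ρ) (c + 2 * ρ)).indicator 1 τ := by
    intro c x hx hxc
    by_cases hx0 : h x = 0
    · rw [hx0, mul_zero, abs_zero]
      exact mul_nonneg (mul_nonneg hM0 hε0) (indicator_nonneg (fun _ _ => zero_le_one) _)
    · have h1 := abs_lt.1 (hsupp x hx hx0)
      have h2 := abs_le.1 hxc
      rw [indicator_of_mem (show τ ∈ Ioo (c - 2 * ρ) (c + 2 * ρ) from
        ⟨by linarith [h1.2, h2.1], by linarith [h1.1, h2.2]⟩), Pi.one_apply, mul_one, abs_mul,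
        abs_of_nonneg (h0 x hx)]
      exact mul_le_mul (hM x hx) (hε x hx) (h0 x hx) hM0
  have b1 := abs_le.1 (hbd a (a + s) hAm (by simp [abs_of_pos hs0]))
  have b2 := abs_le.1 (hbd b (b - s) hBm (by simp [abs_of_pos hs0]))
  linarith [b1.2, b2.1]

/-- The two-dimensional form of `integral_deriv_slice_ge`, for a function supported in a strip
`|y + x - t| < ρ`: only lines that meet the strip near the boundary carry boundary terms. -/
lemma integral_deriv_prod_ge {a b k ε t ρ M : ℝ} {G N : ℝ × ℝ → ℝ} (hab : a < b) (hρ : 0 < ρ)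
    (hlip : ∀ y ∈ Ioo a b, LocallyLipschitzOn (Ioo a b) fun x => G (y, x))
    (h0 : ∀ z ∈ Ioo a b ×ˢ Ioo a b, 0 ≤ G z) (hε : ∀ z ∈ Ioo a b ×ˢ Ioo a b, G z ≤ ε)
    (hsupp : ∀ z ∈ Ioo a b ×ˢ Ioo a b, G z ≠ 0 → |z.1 + z.2 - t| < ρ)
    (hM : ∀ x ∈ Ioo a b, |x - k| ≤ M)
    (hN : ∀ z ∈ Ioo a b ×ˢ Ioo a b, z.1 + z.2 ≠ t →
      N z = (z.2 - k) * deriv (fun x => G (z.1, x)) z.2 - G z)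
    (hint : IntegrableOn N (Ioo a b ×ˢ Ioo a b)) :
    -(8 * M * ρ + 4 * ρ * (b - a)) * ε ≤ ∫ z in Ioo a b ×ˢ Ioo a b, N z := by
  have hmid : (a + b) / 2 ∈ Ioo a b := ⟨by linarith, by linarith⟩
  have hε0 : 0 ≤ ε := (h0 (_, _) ⟨hmid, hmid⟩).trans (hε _ ⟨hmid, hmid⟩)
  have hM0 : 0 ≤ M := (abs_nonneg _).trans (hM _ hmid)
  have hint' : Integrable N ((volume.restrict (Ioo a b)).prod (volume.restrict (Ioo a b))) := by
    rw [Measure.prod_restrict]; exact hint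
  set J : ℝ → ℝ → ℝ := fun c y => (Ioo (c - 2 * ρ) (c + 2 * ρ)).indicator 1 (t - y) with hJ
  have hJe : ∀ c, J c = (Ioo (t - c - 2 * ρ) (t - c + 2 * ρ)).indicator 1 := by
    intro c
    funext y
    simp only [hJ, indicator_apply, mem_Ioo]
    congr 1
    apply propext
    constructor <;> rintro ⟨h1, h2⟩ <;> constructor <;> linarith
  have hJi : ∀ c, Integrable (J c) := by
    intro c
    rw [hJe, integrable_indicator_iff measurableSet_Ioo]
    exact integrableOn_const (by simp)
  have hJ4 : ∀ c, ∫ y in Ioo a b, J c y ≤ 4 * ρ := by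
    intro c
    have h1 : ∫ y in Ioo a b, J c y ≤ ∫ y, J c y :=
      setIntegral_le_integral (hJi c)
        (ae_of_all _ fun x => indicator_nonneg (fun _ _ => zero_le_one) _)
    have h2 : ∫ y, J c y = 4 * ρ := by
      rw [hJe, integral_indicator measurableSet_Ioo]
      simp only [Pi.one_apply]
      rw [setIntegral_const, Real.volume_real_Ioo_of_le (by linarith), smul_eq_mul]
      ring
    linarith
  set lower : ℝ → ℝ := fun y => -(M * ε * (J a y + J b y) + 4 * ρ * ε) with hlower
  have hlowint : IntegrableOn lower (Ioo a b) :=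
    (((((hJi a).add (hJi b)).integrableOn).const_mul (M * ε)).add
      (integrableOn_const (by simp))).neg
  rw [Measure.volume_eq_prod, setIntegral_prod _ hint]
  have hle : ∫ y in Ioo a b, lower y ≤ ∫ y in Ioo a b, ∫ x in Ioo a b, N (y, x) := by
    refine integral_mono_ae hlowint hint'.integral_prod_left ?_
    filter_upwards [hint'.prod_right_ae, ae_restrict_mem measurableSet_Ioo] with y hy hyI
    have heq : (fun x => N (y, x)) =ᵐ[volume.restrict (Ioo a b)]
        fun x => (x - k) * deriv (fun x => G (y, x)) x - G (y, x) := by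
      have hne : ∀ᵐ x ∂(volume.restrict (Ioo a b)), x ≠ t - y :=
        ae_restrict_of_ae (by simp [ae_iff, measure_singleton])
      filter_upwards [hne, ae_restrict_mem measurableSet_Ioo] with x hx hxI
      exact hN (y, x) ⟨hyI, hxI⟩ fun h => hx (by linarith [show y + x = t from h])
    rw [integral_congr_ae heq]
    refine integral_deriv_slice_ge hab hρ (hlip y hyI) (fun x hx => h0 _ ⟨hyI, hx⟩)
      (fun x hx => hε _ ⟨hyI, hx⟩) (fun x hx hx0 => ?_) hM (hy.congr heq)
    have := hsupp (y, x) ⟨hyI, hx⟩ hx0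
    rwa [show y + x - t = x - (t - y) by ring] at this
  refine le_trans ?_ hle
  have hval : ∫ y in Ioo a b, lower y =
      -(M * ε * ((∫ y in Ioo a b, J a y) + ∫ y in Ioo a b, J b y) + (b - a) * (4 * ρ * ε)) := by
    have i1 : IntegrableOn (fun y => M * ε * (J a y + J b y)) (Ioo a b) :=
      ((hJi a).add (hJi b)).integrableOn.const_mul (M * ε)
    have i2 : IntegrableOn (fun _ : ℝ => 4 * ρ * ε) (Ioo a b) := integrableOn_const (by simp)
    simp only [hlower]
    rw [integral_neg, integral_add i1 i2, integral_const_mul,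
      integral_add (hJi a).integrableOn (hJi b).integrableOn, setIntegral_const,
      Real.volume_real_Ioo_of_le hab.le, smul_eq_mul]
  rw [hval]
  have := mul_le_mul_of_nonneg_left (add_le_add (hJ4 a) (hJ4 b)) (mul_nonneg hM0 hε0)
  linarith

/-! ### Coordinates on the plane -/

/-- The measurable equivalence `(x₁, x₂) ↦ (x₁, x₂)` from the product to the Euclidean plane. -/
def pairEquiv : ℝ × ℝ ≃ᵐ Plane :=
  (MeasurableEquiv.finTwoArrow (α := ℝ)).symm.trans (MeasurableEquiv.toLp 2 (Fin 2 → ℝ))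

lemma pairEquiv_apply (z : ℝ × ℝ) : pairEquiv z = z.1 • e₁ + z.2 • e₂ := by
  ext i
  fin_cases i <;> simp [pairEquiv, e₁, e₂, MeasurableEquiv.finTwoArrow]

lemma measurePreserving_pairEquiv : MeasurePreserving pairEquiv :=
  ((volume_preserving_finTwoArrow ℝ).symm _).trans (PiLp.volume_preserving_toLp (Fin 2))

lemma pairEquiv_zero (z : ℝ × ℝ) : pairEquiv z 0 = z.1 := by
  simp [pairEquiv_apply, e₁, e₂]

lemma pairEquiv_one (z : ℝ × ℝ) : pairEquiv z 1 = z.2 := by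
  simp [pairEquiv_apply, e₁, e₂]

lemma pairEquiv_preimage_openSquare (a : ℝ) :
    pairEquiv ⁻¹' openSquare a = Ioo a (a + 1) ×ˢ Ioo a (a + 1) := by
  ext z
  simp only [mem_preimage, openSquare, mem_ofPred_eq, pairEquiv_zero, pairEquiv_one, mem_prod]

lemma pairEquiv_preimage_square (a : ℝ) :
    pairEquiv ⁻¹' square a = Icc a (a + 1) ×ˢ Icc a (a + 1) := by
  ext z
  simp only [mem_preimage, square, mem_ofPred_eq, pairEquiv_zero, pairEquiv_one, mem_prod]

lemma uniformSquare_eq (a : ℝ) : uniformSquare a = volume.restrict (openSquare a) := by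
  have h : (Icc a (a + 1) ×ˢ Icc a (a + 1) : Set (ℝ × ℝ)) =ᵐ[volume]
      (Ioo a (a + 1) ×ˢ Ioo a (a + 1) : Set (ℝ × ℝ)) :=
    Measure.set_prod_ae_eq Ioo_ae_eq_Icc.symm Ioo_ae_eq_Icc.symm
  rw [← pairEquiv_preimage_openSquare, ← pairEquiv_preimage_square] at h
  have h2 := (measurePreserving_pairEquiv.symm
    pairEquiv).quasiMeasurePreserving.preimage_ae_eq h
  simp only [← preimage_comp, MeasurableEquiv.self_comp_symm, preimage_id] at h2
  exact Measure.restrict_congr_set h2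

lemma volume_openSquare_lt_top (a : ℝ) : volume (openSquare a) < ⊤ := by
  rw [← measurePreserving_pairEquiv.measure_preimage_equiv, pairEquiv_preimage_openSquare,
    Measure.volume_eq_prod, Measure.prod_prod]
  exact ENNReal.mul_lt_top (by simp) (by simp)

instance (a : ℝ) : IsFiniteMeasure (volume.restrict (openSquare a)) :=
  ⟨by simpa using volume_openSquare_lt_top a⟩

/-- Lower bound for `∫ (xᵢ - k) ∂ᵢG - G` over the open square, for a function `G` with values in
`[0, ε]` and support in a strip of half-width `ρ`; in coordinates `T` whose second one is `xᵢ`. -/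
lemma integral_deriv_square_ge {k ε t ρ M : ℝ} {G N : Plane → ℝ} (T : ℝ × ℝ ≃ᵐ Plane)
    (hT : MeasurePreserving T) {w v : Plane} (hTe : ∀ z, T z = z.1 • w + z.2 • v) (i : Fin 2)
    (hTi : ∀ z, T z i = z.2) (hTs : ∀ z, T z 0 + T z 1 = z.1 + z.2)
    (hpre : T ⁻¹' openSquare a = Ioo a (a + 1) ×ˢ Ioo a (a + 1)) (hρ : 0 < ρ)
    (hlip : LocallyLipschitzOn (openSquare a) G)
    (h0 : ∀ x ∈ openSquare a, 0 ≤ G x) (hε : ∀ x ∈ openSquare a, G x ≤ ε)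
    (hsupp : ∀ x ∈ openSquare a, G x ≠ 0 → |x 0 + x 1 - t| < ρ)
    (hM : ∀ x ∈ Ioo a (a + 1), |x - k| ≤ M)
    (hN : ∀ x ∈ openSquare a, x 0 + x 1 ≠ t →
      N x = (x i - k) * deriv (fun s : ℝ => G (x + s • v)) 0 - G x)
    (hint : IntegrableOn N (openSquare a)) :
    -(8 * M * ρ + 4 * ρ) * ε ≤ ∫ x in openSquare a, N x := by
  have hmem : ∀ z : ℝ × ℝ, z ∈ Ioo a (a + 1) ×ˢ Ioo a (a + 1) → T z ∈ openSquare a :=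
    fun z hz => by rwa [← hpre] at hz
  rw [← hT.setIntegral_preimage_emb T.measurableEmbedding, hpre]
  have hmain := integral_deriv_prod_ge (a := a) (b := a + 1) (k := k) (ε := ε) (t := t) (ρ := ρ)
    (M := M) (G := fun z => G (T z)) (N := fun z => N (T z)) (by linarith) hρ ?_
    (fun z hz => h0 _ (hmem z hz)) (fun z hz => hε _ (hmem z hz)) ?_ hM ?_ ?_
  · rwa [show (a + 1 - a) = 1 by ring, mul_one] at hmain
  · intro y hy
    have hTl : LocallyLipschitz fun x : ℝ => T (y, x) := by
      have : (fun x : ℝ => T (y, x)) = fun x : ℝ => y • w + x • v := funext fun x => hTe _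
      rw [this]
      exact ContDiff.locallyLipschitz (𝕂 := ℝ)
        (contDiff_const.add (contDiff_id.smul contDiff_const))
    intro x hx
    obtain ⟨K, s, hs, hK⟩ := hlip (hmem (y, x) ⟨hy, hx⟩)
    obtain ⟨K', s', hs', hK'⟩ := hTl x
    have hTc : ContinuousWithinAt (fun x : ℝ => T (y, x)) (Ioo a (a + 1)) x :=
      hTl.continuous.continuousWithinAt
    have hmaps : MapsTo (fun x : ℝ => T (y, x)) (Ioo a (a + 1)) (openSquare a) :=
      fun x hx => hmem (y, x) ⟨hy, hx⟩
    have hpreim : (fun x : ℝ => T (y, x)) ⁻¹' s ∈ 𝓝[Ioo a (a + 1)] x :=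
      (tendsto_nhdsWithin_of_tendsto_nhds_of_eventually_within _ hTc
        (eventually_mem_nhdsWithin.mono hmaps)) hs
    exact ⟨K * K', _, inter_mem hpreim (nhdsWithin_le_nhds hs'),
      hK.comp (hK'.mono inter_subset_right) fun x hx => hx.1⟩
  · intro z hz hz0
    have := hsupp _ (hmem z hz) hz0
    rwa [hTs] at this
  · intro z hz hzt
    beta_reduce
    rw [hN _ (hmem z hz) (by rwa [hTs]), hTi]
    congr 2
    have h1 : (fun x : ℝ => G (T (z.1, x))) = fun x => G (T z + (x - z.2) • v) := by
      funext x
      rw [hTe, hTe]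
      congr 1
      module
    rw [h1, deriv_comp_sub_const (f := fun s : ℝ => G (T z + s • v)), sub_self]
  · rw [← hpre]
    exact (hT.integrableOn_comp_preimage T.measurableEmbedding).2 hint

/-! ### The profit density in coordinates -/

lemma gradient_apply_zero (f : Plane → ℝ) (x : Plane) : gradient f x 0 = fderiv ℝ f x e₁ := by
  have h : inner ℝ (gradient f x) e₁ = fderiv ℝ f x e₁ := InnerProductSpace.toDual_symm_apply
  rw [← h, PiLp.inner_apply, Fin.sum_univ_two]
  simp [e₁]

lemma gradient_apply_one (f : Plane → ℝ) (x : Plane) : gradient f x 1 = fderiv ℝ f x e₂ := by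
  have h : inner ℝ (gradient f x) e₂ = fderiv ℝ f x e₂ := InnerProductSpace.toDual_symm_apply
  rw [← h, PiLp.inner_apply, Fin.sum_univ_two]
  simp [e₂]

lemma measurable_gradient_apply (f : Plane → ℝ) (i : Fin 2) :
    Measurable fun x => gradient f x i := by
  have h : Measurable (gradient f) :=
    (InnerProductSpace.toDual ℝ Plane).symm.continuous.measurable.comp (measurable_fderiv ℝ f)
  have hi : Continuous fun x : Plane => x i := by fun_prop
  exact hi.measurable.comp h

lemma profitDensity_quadraticCost (f : Plane → ℝ) (x : Plane) :
    profitDensity quadraticCost f x = x 0 * gradient f x 0 + x 1 * gradient f x 1 - f x -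
      (gradient f x 0 ^ 2 + gradient f x 1 ^ 2) / 2 := by
  simp only [profitDensity, quadraticCost, EuclideanSpace.norm_sq_eq, Fin.sum_univ_two,
    PiLp.inner_apply, Real.norm_eq_abs, sq_abs]
  simp
  ring

lemma memLp_coord (a : ℝ) (i : Fin 2) :
    MemLp (fun x : Plane => x i) 2 (volume.restrict (openSquare a)) := by
  have hi : Continuous fun x : Plane => x i := by fun_prop
  refine MemLp.of_bound hi.aestronglyMeasurable (|a| + 1) ?_
  filter_upwards [ae_restrict_mem (isOpen_openSquare a).measurableSet] with x hx
  have h1 : x i ∈ Ioo a (a + 1) := by fin_cases i; exacts [hx.1, hx.2]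
  rw [Real.norm_eq_abs, abs_le]
  constructor <;> linarith [h1.1, h1.2, neg_abs_le a, le_abs_self a]

lemma Admissible.continuousOn (hu : Admissible (square a) u) : ContinuousOn u (openSquare a) :=
  hu.convexOn.continuousOn_interior.mono (openSquare_subset_interior a)

lemma Admissible.integrableOn (hu : Admissible (square a) u) :
    IntegrableOn u (openSquare a) := by
  have hmeas := hu.continuousOn.aestronglyMeasurable (μ := volume)
    (isOpen_openSquare a).measurableSet
  refine Integrable.of_bound hmeas (u !₂[a + 1, a + 1]) ?_
  filter_upwards [ae_restrict_mem (isOpen_openSquare a).measurableSet] with x hx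
  have hxS := openSquare_subset_square a hx
  rw [Real.norm_eq_abs, abs_of_nonneg (hu.nonneg x hxS)]
  refine hu.mono x hxS _ (by constructor <;> simp) fun i => ?_
  fin_cases i
  · simpa using hx.1.2.le
  · simpa using hx.2.2.le

/-- A utility of finite profit has a square integrable gradient, because its profit density is
`|x|²/2 - u - |x - Du|²/2`. -/
lemma Admissible.memLp_gradient (hu : Admissible (square a) u)
    (hint : IntegrableOn (profitDensity quadraticCost u) (openSquare a)) (i : Fin 2) :
    MemLp (fun x => gradient u x i) 2 (volume.restrict (openSquare a)) := by
  have hd : ∀ j : Fin 2, Measurable fun x : Plane => x j - gradient u x j := fun j =>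
    (by fun_prop : Continuous fun x : Plane => x j).measurable.sub (measurable_gradient_apply u j)
  have hsum : IntegrableOn (fun x : Plane => (x 0 - gradient u x 0) ^ 2 +
      (x 1 - gradient u x 1) ^ 2) (openSquare a) := by
    have h1 := ((((memLp_coord a 0).integrable_sq.add (memLp_coord a 1).integrable_sq).sub
      (hu.integrableOn.const_mul 2)).sub (hint.const_mul 2))
    refine h1.congr (ae_of_all _ fun x => ?_)
    simp only [Pi.add_apply, Pi.sub_apply, profitDensity_quadraticCost]
    ring
  have hdi : MemLp (fun x : Plane => x i - gradient u x i) 2 (volume.restrict (openSquare a)) := by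
    rw [memLp_two_iff_integrable_sq (hd i).aestronglyMeasurable]
    refine Integrable.mono' hsum ((hd i).pow_const 2).aestronglyMeasurable (ae_of_all _ fun x => ?_)
    rw [Real.norm_eq_abs, abs_of_nonneg (sq_nonneg _)]
    fin_cases i
    · exact le_add_of_nonneg_right (sq_nonneg _)
    · exact le_add_of_nonneg_left (sq_nonneg _)
  refine ((memLp_coord a i).sub hdi).ae_eq (ae_of_all _ fun x => ?_)
  simp

/-- The set of customers in the open square whose utility `u` lies below `β + k (x₁ + x₂)`. -/
def belowSet (a β k : ℝ) (u : Plane → ℝ) : Set Plane :=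
  {x | x ∈ openSquare a ∧ u x < β + k * (x 0 + x 1)}

lemma Admissible.isOpen_belowSet (hu : Admissible (square a) u) (β k : ℝ) :
    IsOpen (belowSet a β k u) := by
  have hl : Continuous fun x : Plane => β + k * (x 0 + x 1) := by fun_prop
  have := (hu.continuousOn.sub hl.continuousOn).isOpen_inter_preimage
    (isOpen_openSquare a) (isOpen_Iio (a := (0 : ℝ)))
  convert! this using 1
  ext x
  simp [belowSet]

/-- Raising a utility to an affine function of `x₁ + x₂` with nonnegative slope. -/
def raiseTo (β k : ℝ) (u : Plane → ℝ) (x : Plane) : ℝ := max (u x) (β + k * (x 0 + x 1))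

lemma Admissible.admissible_raiseTo (hu : Admissible (square a) u) (β : ℝ) {k : ℝ} (hk : 0 ≤ k) :
    Admissible (square a) (raiseTo β k u) where
  nonneg x hx := (hu.nonneg x hx).trans (le_max_left _ _)
  convexOn := by
    refine hu.convexOn.sup ⟨hu.convexOn.1, fun x _ y _ s t _ _ hst => le_of_eq ?_⟩
    simp only [PiLp.add_apply, PiLp.smul_apply, smul_eq_mul]
    linear_combination (-β) * hst
  mono x hx y hy hxy := by
    refine max_le_max (hu.mono x hx y hy hxy) ?_
    have := mul_le_mul_of_nonneg_left (add_le_add (hxy 0) (hxy 1)) hk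
    linarith

lemma fderiv_affine (β k : ℝ) (x w : Plane) :
    fderiv ℝ (fun x : Plane => β + k * (x 0 + x 1)) x w = k * (w 0 + w 1) := by
  have h0 : HasFDerivAt (fun x : Plane => x 0 + x 1)
      (EuclideanSpace.proj (𝕜 := ℝ) (0 : Fin 2) + EuclideanSpace.proj (1 : Fin 2)) x :=
    (EuclideanSpace.proj (𝕜 := ℝ) (0 : Fin 2)).hasFDerivAt.add
      (EuclideanSpace.proj (𝕜 := ℝ) (1 : Fin 2)).hasFDerivAt
  rw [((h0.const_mul k).const_add β).fderiv]
  simp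
  ring

lemma Admissible.raiseTo_eventuallyEq (hu : Admissible (square a) u) {β k : ℝ} {x : Plane}
    (hx : x ∈ belowSet a β k u) :
    raiseTo β k u =ᶠ[𝓝 x] fun x => β + k * (x 0 + x 1) := by
  filter_upwards [(hu.isOpen_belowSet β k).mem_nhds hx] with y hy
  exact max_eq_right hy.2.le

/-- The gain in profit density from raising `u` to an affine function with gradient `(k, k)`. -/
def raiseGain (β k : ℝ) (u : Plane → ℝ) (x : Plane) : ℝ :=
  (x 0 - k) * (k - gradient u x 0) + (x 1 - k) * (k - gradient u x 1) -
    (β + k * (x 0 + x 1) - u x) + ((k - gradient u x 0) ^ 2 + (k - gradient u x 1) ^ 2) / 2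

lemma Admissible.memLp_sub_gradient (hu : Admissible (square a) u)
    (hint : IntegrableOn (profitDensity quadraticCost u) (openSquare a)) (k : ℝ)
    (i : Fin 2) :
    MemLp (fun x => k - gradient u x i) 2 (volume.restrict (openSquare a)) :=
  (memLp_const k).sub (hu.memLp_gradient hint i)

lemma Admissible.integrableOn_linear (hu : Admissible (square a) u)
    (hint : IntegrableOn (profitDensity quadraticCost u) (openSquare a)) (β k : ℝ)
    (i : Fin 2) :
    IntegrableOn ((belowSet a β k u).indicator
      fun x => (x i - k) * (k - gradient u x i)) (openSquare a) :=
  (((memLp_coord a i).sub (memLp_const k)).integrable_mul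
    (hu.memLp_sub_gradient hint k i)).indicator (hu.isOpen_belowSet β k).measurableSet

lemma Admissible.integrableOn_sq (hu : Admissible (square a) u)
    (hint : IntegrableOn (profitDensity quadraticCost u) (openSquare a)) (β k : ℝ)
    (i : Fin 2) :
    IntegrableOn ((belowSet a β k u).indicator
      fun x => (k - gradient u x i) ^ 2) (openSquare a) :=
  (hu.memLp_sub_gradient hint k i).integrable_sq.indicator
    (hu.isOpen_belowSet β k).measurableSet

lemma Admissible.integrableOn_gap (hu : Admissible (square a) u) (β k : ℝ) :
    IntegrableOn ((belowSet a β k u).indicator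
      fun x => β + k * (x 0 + x 1) - u x) (openSquare a) := by
  refine Integrable.indicator ?_ (hu.isOpen_belowSet β k).measurableSet
  have h01 := ((memLp_coord a 0).integrable one_le_two).add
    ((memLp_coord a 1).integrable one_le_two)
  exact ((integrable_const β).add (h01.const_mul k)).sub hu.integrableOn

/-- A profit maximizer does not gain by being raised to an affine function. -/
lemma IsProfitMaximizer.integral_raiseGain_nonpos (hmax : IsProfitMaximizer a u) {β k : ℝ}
    (hk : 0 ≤ k) (hnull : ∀ᵐ x ∂volume.restrict (openSquare a), u x ≠ β + k * (x 0 + x 1)) :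
    ∫ x in openSquare a, (belowSet a β k u).indicator (raiseGain β k u) x ≤ 0 := by
  obtain ⟨hu, hint, hopt⟩ := hmax
  rw [uniformSquare_eq] at hint hopt
  have hint' : IntegrableOn (profitDensity quadraticCost u) (openSquare a) := hint
  have hgain : IntegrableOn ((belowSet a β k u).indicator (raiseGain β k u)) (openSquare a) := by
    have h1 := (((hu.integrableOn_linear hint' β k 0).add (hu.integrableOn_linear hint' β k 1)).sub
      (hu.integrableOn_gap β k)).add
      (((hu.integrableOn_sq hint' β k 0).add (hu.integrableOn_sq hint' β k 1)).div_const 2)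
    refine h1.congr (ae_of_all _ fun x => ?_)
    by_cases hx : x ∈ belowSet a β k u <;> simp [hx, raiseGain]
  have hae : profitDensity quadraticCost (raiseTo β k u) =ᵐ[volume.restrict (openSquare a)]
      profitDensity quadraticCost u + (belowSet a β k u).indicator (raiseGain β k u) := by
    filter_upwards [hnull, ae_restrict_mem (isOpen_openSquare a).measurableSet] with x hx hxO
    by_cases hxD : x ∈ belowSet a β k u
    · have hev := hu.raiseTo_eventuallyEq hxD
      rw [Pi.add_apply, indicator_of_mem hxD, profitDensity_quadraticCost,
        profitDensity_quadraticCost, gradient_apply_zero (raiseTo β k u),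
        gradient_apply_one (raiseTo β k u), hev.fderiv_eq, fderiv_affine, fderiv_affine,
        hev.eq_of_nhds]
      simp only [raiseGain, e₁, e₂]
      simp
      ring
    · have hgt : β + k * (x 0 + x 1) < u x :=
        lt_of_le_of_ne (not_lt.1 fun hlt => hxD ⟨hxO, hlt⟩) hx.symm
      have hl : Continuous fun x : Plane => β + k * (x 0 + x 1) := by fun_prop
      have hev : raiseTo β k u =ᶠ[𝓝 x] u := by
        filter_upwards [hl.continuousAt.eventually_lt (hu.continuousOn.continuousAt
          ((isOpen_openSquare a).mem_nhds hxO)) hgt] with y hy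
        exact max_eq_left hy.le
      rw [Pi.add_apply, indicator_of_notMem hxD, add_zero, profitDensity_quadraticCost,
        profitDensity_quadraticCost, gradient_apply_zero (raiseTo β k u),
        gradient_apply_one (raiseTo β k u), hev.fderiv_eq, hev.eq_of_nhds,
        gradient_apply_zero u, gradient_apply_one u]
  have hle := hopt _ (hu.admissible_raiseTo β hk) ((hint.add hgain).congr hae.symm)
  simp only [profit] at hle
  rw [integral_congr_ae hae, integral_add' hint hgain] at hle
  linarith

/-! ### A kink can be smoothed with profit -/

lemma Ansatz.hasFDerivAt_strip (h : Ansatz a t₀ t₁ C₀ u) {x : Plane} (hx : x ∈ openSquare a)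
    (hx₀ : t₀ < x 0 + x 1) (hx₁ : x 0 + x 1 < t₁) :
    HasFDerivAt u (profileDeriv a (x 0 + x 1) •
      (EuclideanSpace.proj (𝕜 := ℝ) (0 : Fin 2) + EuclideanSpace.proj (1 : Fin 2))) x := by
  have hs : HasFDerivAt (fun x : Plane => x 0 + x 1)
      (EuclideanSpace.proj (𝕜 := ℝ) (0 : Fin 2) + EuclideanSpace.proj (1 : Fin 2)) x :=
    (EuclideanSpace.proj (𝕜 := ℝ) (0 : Fin 2)).hasFDerivAt.add
      (EuclideanSpace.proj (𝕜 := ℝ) (1 : Fin 2)).hasFDerivAt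
  have hp := (hasDerivAt_profile C₀ (h.lower.trans hx₀)).comp_hasFDerivAt x hs
  refine hp.congr_of_eventuallyEq ?_
  have ho : IsOpen {y : Plane | y 0 + y 1 < t₁} :=
    isOpen_lt (by fun_prop : Continuous fun y : Plane => y 0 + y 1) continuous_const
  filter_upwards [(isOpen_outerRegion a t₀).mem_nhds ⟨hx, hx₀⟩, ho.mem_nhds hx₁] with y hy hy1
  exact h.eq_profile (openSquare_subset_square a hy.1) hy.2 (le_of_lt hy1)

lemma Ansatz.gradient_strip (h : Ansatz a t₀ t₁ C₀ u) {x : Plane} (hx : x ∈ openSquare a)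
    (hx₀ : t₀ < x 0 + x 1) (hx₁ : x 0 + x 1 < t₁) (i : Fin 2) :
    gradient u x i = profileDeriv a (x 0 + x 1) := by
  have hf := (h.hasFDerivAt_strip hx hx₀ hx₁).fderiv
  fin_cases i
  · change gradient u x 0 = _
    rw [gradient_apply_zero, hf]
    simp [e₁]
  · change gradient u x 1 = _
    rw [gradient_apply_one, hf]
    simp [e₂]

/-- A parallelogram of base `2η` and height `σ` next to the line `x₁ + x₂ = t`. -/
def parallelogram (t η σ : ℝ) : Set Plane :=
  pairEquiv.symm ⁻¹' regionBetween (fun y => t - y - σ) (fun y => t - y)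
    (Ioo (t / 2 - η) (t / 2 + η))

lemma measurableSet_parallelogram (t η σ : ℝ) : MeasurableSet (parallelogram t η σ) :=
  pairEquiv.symm.measurable
    (measurableSet_regionBetween (by fun_prop) (by fun_prop) measurableSet_Ioo)

lemma volume_parallelogram {t η σ : ℝ} (hη : 0 ≤ η) (hσ : 0 ≤ σ) :
    volume.real (parallelogram t η σ) = 2 * η * σ := by
  have hi : ∀ c : ℝ, IntegrableOn (fun y : ℝ => t - y - c) (Ioo (t / 2 - η) (t / 2 + η)) :=
    fun c => ((by fun_prop : Continuous fun y : ℝ => t - y - c).continuousOn.integrableOn_Icc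
      (a := t / 2 - η) (b := t / 2 + η)).mono_set Ioo_subset_Icc_self
  rw [measureReal_def, parallelogram,
    (measurePreserving_pairEquiv.symm pairEquiv).measure_preimage_equiv, Measure.volume_eq_prod,
    volume_regionBetween_eq_integral (hi σ) (by simpa using hi 0) measurableSet_Ioo
      (fun y _ => by linarith)]
  have he : ∀ y : ℝ, ((fun y => t - y) - fun y => t - y - σ) y = σ := fun y => by simp
  simp only [he]
  rw [setIntegral_const, Real.volume_real_Ioo_of_le (by linarith), smul_eq_mul,
    ENNReal.toReal_ofReal (mul_nonneg (by linarith) hσ)]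
  ring

lemma mem_parallelogram {t η σ : ℝ} {x : Plane} : x ∈ parallelogram t η σ ↔
    x 0 ∈ Ioo (t / 2 - η) (t / 2 + η) ∧ x 1 ∈ Ioo (t - x 0 - σ) (t - x 0) := by
  obtain ⟨z, rfl⟩ := pairEquiv.surjective x
  rw [pairEquiv_zero, pairEquiv_one, parallelogram, mem_preimage, MeasurableEquiv.symm_apply_apply]
  rfl

/-- If `u` has a kink along the segment, then raising it there by `ε`, to an affine function with
gradient between the two one-sided ones, gains profit of order `ε` and loses only of order `ε²`. -/
lemma Ansatz.not_isProfitMaximizer_of_kink (h : Ansatz a t₀ t₁ C₀ u) {κ : ℝ} (hκ : 0 < κ)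
    (hkink : ∀ x ∈ square a, t₁ ≤ x 0 + x 1 →
      profile a C₀ t₁ + (profileDeriv a t₁ + κ) * (x 0 + x 1 - t₁) ≤ u x) :
    ¬ IsProfitMaximizer a u := by
  intro hmax
  have hu := hmax.1
  have hint : IntegrableOn (profitDensity quadraticCost u) (openSquare a) := by
    have := hmax.2.1
    rwa [uniformSquare_eq] at this
  set c := profile a C₀ t₁ with hc
  set m := profileDeriv a t₁ with hm
  have hm0 : 0 < m := h.profileDeriv_pos
  set k := m + κ / 2 with hk
  have hk0 : 0 < k := by positivity
  have hmid := h.middle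
  have h2a := h.two_mul_lt
  have hup := h.upper
  -- `u` lies above the affine function through the segment with slope `k` by a fixed angle
  have hangle : ∀ x ∈ square a, c + k * (x 0 + x 1 - t₁) + κ / 2 * |x 0 + x 1 - t₁| ≤ u x := by
    intro x hx
    rcases le_total t₁ (x 0 + x 1) with hr | hr
    · rw [abs_of_nonneg (by linarith)]
      have := hkink x hx hr
      rw [hk]
      linarith
    · rw [abs_of_nonpos (by linarith)]
      have := h.tangent_le hu hx
      rw [hk]
      linarith
  set M := |k| + |a| + 1 with hM
  have hM0 : 0 < M := by positivity
  obtain ⟨η, hη, hη1, hη2⟩ : ∃ η : ℝ, 0 < η ∧ 2 * η < t₁ / 2 - a ∧ 2 * η < a + 1 - t₁ / 2 := by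
    have h0 : 0 < min (t₁ / 2 - a) (a + 1 - t₁ / 2) := lt_min (by linarith) (by linarith)
    exact ⟨min (t₁ / 2 - a) (a + 1 - t₁ / 2) / 3, by positivity,
      by linarith [min_le_left (t₁ / 2 - a) (a + 1 - t₁ / 2)],
      by linarith [min_le_right (t₁ / 2 - a) (a + 1 - t₁ / 2)]⟩
  -- the choice of `ε`
  obtain ⟨δ, hδ, hsmall⟩ : ∃ δ : ℝ, 0 < δ ∧ ∀ ε ∈ Ioo 0 δ, 2 * ε / κ < t₁ - t₀ ∧
      ε / (k + 1) < η ∧ ε / (k + 1) < t₁ - t₀ ∧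
      4 * (8 * M + 4) / κ * ε < κ ^ 2 * η / (2 * (k + 1)) := by
    have hlin : ∀ p q : ℝ, 0 < q → ∀ᶠ ε : ℝ in 𝓝[>] 0, p * ε < q := by
      intro p q hq
      have : Continuous fun ε : ℝ => p * ε := by fun_prop
      exact nhdsWithin_le_nhds ((this.tendsto 0).eventually (gt_mem_nhds (by simpa using hq)))
    have hev : ∀ᶠ ε : ℝ in 𝓝[>] 0, 2 * ε / κ < t₁ - t₀ ∧
        ε / (k + 1) < η ∧ ε / (k + 1) < t₁ - t₀ ∧
        4 * (8 * M + 4) / κ * ε < κ ^ 2 * η / (2 * (k + 1)) := by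
      filter_upwards [hlin (2 / κ) (t₁ - t₀) (by linarith), hlin (1 / (k + 1)) η hη,
        hlin (1 / (k + 1)) (t₁ - t₀) (by linarith), hlin (4 * (8 * M + 4) / κ)
        (κ ^ 2 * η / (2 * (k + 1))) (by positivity)] with ε h1 h2 h3 h4
      exact ⟨by rwa [div_mul_eq_mul_div] at h1, by rwa [div_mul_eq_mul_div, one_mul] at h2,
        by rwa [div_mul_eq_mul_div, one_mul] at h3, h4⟩
    obtain ⟨δ, hδ, hsub⟩ := mem_nhdsGT_iff_exists_Ioo_subset.1 hev
    exact ⟨δ, hδ, fun ε hε => hsub hε⟩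
  obtain ⟨ε, hεδ, hnull⟩ : ∃ ε ∈ Ioo 0 δ, ∀ᵐ x ∂volume.restrict (openSquare a),
      u x ≠ (c - k * t₁ + ε) + k * (x 0 + x 1) := by
    have hcont : ContinuousOn (fun x : Plane => u x - (c - k * t₁ + k * (x 0 + x 1)))
        (openSquare a) :=
      hu.continuousOn.sub
        (by fun_prop : Continuous fun x : Plane => c - k * t₁ + k * (x 0 + x 1)).continuousOn
    have hmeas := (hcont.aemeasurable (μ := volume)
      (isOpen_openSquare a).measurableSet).nullMeasurable
    have hct := Measure.countable_meas_level_set_pos₀ hmeas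
    have hne : (Ioo 0 δ).Nonempty := nonempty_Ioo.2 hδ
    obtain ⟨ε, hεc, hεδ⟩ := (hct.dense_compl ℝ).exists_mem_open isOpen_Ioo hne
    refine ⟨ε, hεδ, ?_⟩
    rw [ae_iff]
    rw [mem_compl_iff, mem_ofPred_eq, not_lt] at hεc
    refine le_antisymm ((measure_mono fun x hx => ?_).trans hεc) zero_le
    have hx' := not_not.1 hx
    change u x - (c - k * t₁ + k * (x 0 + x 1)) = ε
    rw [hx']
    ring
  obtain ⟨hs1, hs2, hs3, hs4⟩ := hsmall ε hεδ
  have hε0 : 0 < ε := hεδ.1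
  set β := c - k * t₁ + ε with hβ
  set ρ := 2 * ε / κ with hρ
  have hρ0 : 0 < ρ := by positivity
  set σ := ε / (k + 1) with hσ
  have hσ0 : 0 < σ := by positivity
  set D := belowSet a β k u with hD
  have haff : ∀ x : Plane, β + k * (x 0 + x 1) = c + k * (x 0 + x 1 - t₁) + ε := by
    intro x; rw [hβ]; ring
  set G : Plane → ℝ := fun x => raiseTo β k u x - u x with hG
  have hG0 : ∀ x, 0 ≤ G x := fun x => sub_nonneg.2 (le_max_left _ _)
  have hGD : ∀ x ∈ D, G x = β + k * (x 0 + x 1) - u x := fun x hx => by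
    simp only [hG, raiseTo, max_eq_right hx.2.le]
  have hGn : ∀ x ∈ openSquare a, x ∉ D → G x = 0 := fun x hx hxD => by
    have : β + k * (x 0 + x 1) ≤ u x := not_lt.1 fun hlt => hxD ⟨hx, hlt⟩
    simp only [hG, raiseTo, max_eq_left this, sub_self]
  have hDr : ∀ x ∈ D, |x 0 + x 1 - t₁| < ρ := by
    intro x hx
    have h1 := hangle x (openSquare_subset_square a hx.1)
    have h2 := hx.2
    rw [haff] at h2
    rw [hρ, lt_div_iff₀ hκ]
    linarith
  have hGε : ∀ x ∈ openSquare a, G x ≤ ε := by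
    intro x hx
    by_cases hxD : x ∈ D
    · have h1 := hangle x (openSquare_subset_square a hx)
      have h2 : 0 ≤ κ / 2 * |x 0 + x 1 - t₁| := by positivity
      rw [hGD x hxD, haff]
      linarith
    · rw [hGn x hx hxD]
      exact hε0.le
  have hlip : LocallyLipschitzOn (openSquare a) G := by
    have h1 := ((hu.admissible_raiseTo β hk0.le).convexOn.subset (openSquare_subset_square a)
      (convex_openSquare a)).locallyLipschitzOn (isOpen_openSquare a)
    have h2 := (hu.convexOn.subset (openSquare_subset_square a)
      (convex_openSquare a)).locallyLipschitzOn (isOpen_openSquare a)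
    exact h1.sub h2
  have hdiff : ∀ x ∈ D, x 0 + x 1 ≠ t₁ → DifferentiableAt ℝ u x := by
    intro x hx hne
    have hr := abs_lt.1 (hDr x hx)
    rcases lt_or_gt_of_ne hne with hlt | hgt
    · exact (h.hasFDerivAt_strip hx.1 (by linarith) hlt).differentiableAt
    · exact (h.contDiffAt ⟨hx.1, hgt⟩).differentiableAt (by norm_num)
  have hderivG : ∀ x ∈ openSquare a, x 0 + x 1 ≠ t₁ → ∀ v : Plane, v 0 + v 1 = 1 →
      deriv (fun s : ℝ => G (x + s • v)) 0 = D.indicator (fun x => k - fderiv ℝ u x v) x := by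
    intro x hx hne v hv
    by_cases hxD : x ∈ D
    · rw [indicator_of_mem hxD]
      have hline : HasDerivAt (fun s : ℝ => x + s • v) v 0 := by
        simpa using ((hasDerivAt_id (0 : ℝ)).smul_const v).const_add x
      have hev := hu.raiseTo_eventuallyEq hxD
      have haffd : DifferentiableAt ℝ (fun x : Plane => β + k * (x 0 + x 1)) x := by fun_prop
      have hfd : HasFDerivAt G (fderiv ℝ (fun x : Plane => β + k * (x 0 + x 1)) x -
          fderiv ℝ u x) (x + (0 : ℝ) • v) := by
        simp only [zero_smul, add_zero]
        exact (haffd.hasFDerivAt.congr_of_eventuallyEq hev).sub (hdiff x hxD hne).hasFDerivAt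
      have := (hfd.comp_hasDerivAt (0 : ℝ) hline).deriv
      rw [sub_apply, fderiv_affine, hv, mul_one] at this
      exact this
    · rw [indicator_of_notMem hxD]
      refine IsLocalMin.deriv_eq_zero (Eventually.of_forall fun s => ?_)
      simp only [zero_smul, add_zero]
      rw [hGn x hx hxD]
      exact hG0 _
  have hGint : IntegrableOn G (openSquare a) := by
    refine (hu.integrableOn_gap β k).congr ?_
    filter_upwards [ae_restrict_mem (isOpen_openSquare a).measurableSet] with x hx
    by_cases hxD : x ∈ D
    · rw [indicator_of_mem hxD, hGD x hxD]
    · rw [indicator_of_notMem hxD, hGn x hx hxD]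
  have hsuppG : ∀ x ∈ openSquare a, G x ≠ 0 → |x 0 + x 1 - t₁| < ρ := fun x hx hx0 =>
    hDr x (by_contra fun hxD => hx0 (hGn x hx hxD))
  have hMk : ∀ x ∈ Ioo a (a + 1), |x - k| ≤ M := by
    intro x hx
    rw [hM, abs_le]
    constructor <;> linarith [hx.1, hx.2, neg_abs_le a, le_abs_self a, neg_abs_le k, le_abs_self k]
  set N : Fin 2 → Plane → ℝ := fun i x =>
    D.indicator (fun x => (x i - k) * (k - gradient u x i)) x - G x with hN
  have hNint : ∀ i, IntegrableOn (N i) (openSquare a) := fun i =>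
    (hu.integrableOn_linear hint β k i).sub hGint
  -- the terms that are linear in the perturbation
  have hN1 : -(8 * M * ρ + 4 * ρ) * ε ≤ ∫ x in openSquare a, N 1 x := by
    refine integral_deriv_square_ge (k := k) (t := t₁) pairEquiv measurePreserving_pairEquiv
      pairEquiv_apply 1 pairEquiv_one (fun z => by rw [pairEquiv_zero, pairEquiv_one])
      (pairEquiv_preimage_openSquare a) hρ0 hlip (fun x _ => hG0 x) hGε hsuppG hMk
      (fun x hx hne => ?_) (hNint 1)
    rw [hderivG x hx hne e₂ (by simp [e₂])]
    by_cases hxD : x ∈ D <;> simp [hN, hxD, gradient_apply_one]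
  have hN0 : -(8 * M * ρ + 4 * ρ) * ε ≤ ∫ x in openSquare a, N 0 x := by
    have hsw : ∀ z : ℝ × ℝ, MeasurableEquiv.prodComm.trans pairEquiv z = pairEquiv z.swap :=
      fun _ => rfl
    refine integral_deriv_square_ge (k := k) (t := t₁) (w := e₂) (v := e₁)
      (MeasurableEquiv.prodComm.trans pairEquiv)
      ((Measure.measurePreserving_swap (μ := (volume : Measure ℝ))
        (ν := (volume : Measure ℝ))).trans measurePreserving_pairEquiv)
      (fun z => ?_) 0 (fun z => ?_) (fun z => ?_)
      ?_ hρ0 hlip (fun x _ => hG0 x) hGε hsuppG hMk (fun x hx hne => ?_) (hNint 0)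
    · rw [hsw, pairEquiv_apply, add_comm, Prod.fst_swap, Prod.snd_swap]
    · rw [hsw, pairEquiv_zero, Prod.fst_swap]
    · rw [hsw, pairEquiv_zero, pairEquiv_one, Prod.fst_swap, Prod.snd_swap, add_comm]
    · ext z
      have := Set.ext_iff.1 (pairEquiv_preimage_openSquare a) z.swap
      simp only [mem_preimage, mem_prod, Prod.fst_swap, Prod.snd_swap] at this
      rw [mem_preimage, hsw, this, mem_prod, and_comm]
    · rw [hderivG x hx hne e₁ (by simp [e₁])]
      by_cases hxD : x ∈ D <;> simp [hN, hxD, gradient_apply_zero]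
  -- the quadratic term, on the side of the strip
  set q : Plane → ℝ := fun x => (D.indicator (fun x => (k - gradient u x 0) ^ 2) x +
    D.indicator (fun x => (k - gradient u x 1) ^ 2) x) / 2 with hq
  have hqint : IntegrableOn q (openSquare a) :=
    ((hu.integrableOn_sq hint β k 0).add (hu.integrableOn_sq hint β k 1)).div_const 2
  have hq0 : ∀ x, 0 ≤ q x := fun x => by
    have h1 : ∀ i, 0 ≤ D.indicator (fun x => (k - gradient u x i) ^ 2) x := fun i =>
      indicator_nonneg (fun _ _ => sq_nonneg _) _
    exact div_nonneg (add_nonneg (h1 0) (h1 1)) zero_le_two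
  have hpar : ∀ x ∈ parallelogram t₁ η σ, x ∈ openSquare a ∧ κ ^ 2 / 4 ≤ q x := by
    intro x hx
    obtain ⟨⟨h1, h2⟩, h3, h4⟩ := mem_parallelogram.1 hx
    have hxO : x ∈ openSquare a := by
      constructor <;> constructor <;> linarith
    have hx₀ : t₀ < x 0 + x 1 := by linarith
    have hx₁ : x 0 + x 1 < t₁ := by linarith
    have hxD : x ∈ D := by
      refine ⟨hxO, ?_⟩
      rw [haff, h.eq_profile (openSquare_subset_square a hxO) hx₀ hx₁.le]
      have hle := h.profile_le hx₀ hx₁.le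
      have hr : -σ < x 0 + x 1 - t₁ := by linarith
      have hkσ : k * σ ≤ ε := by
        rw [hσ, mul_div_assoc', div_le_iff₀ (by linarith)]
        nlinarith
      have := mul_lt_mul_of_pos_left hr hk0
      linarith
    have hlt := profileDeriv_lt (h.lower.trans hx₀) hx₁
    have hsq : ∀ i, κ ^ 2 / 4 ≤ (k - gradient u x i) ^ 2 := by
      intro i
      rw [h.gradient_strip hxO hx₀ hx₁]
      have : κ / 2 ≤ k - profileDeriv a (x 0 + x 1) := by rw [hk]; linarith
      nlinarith
    refine ⟨hxO, ?_⟩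
    simp only [hq, indicator_of_mem hxD]
    linarith [hsq 0, hsq 1]
  have hqlow : κ ^ 2 / 4 * (2 * η * σ) ≤ ∫ x in openSquare a, q x := by
    have hsub : parallelogram t₁ η σ ⊆ openSquare a := fun x hx => (hpar x hx).1
    have hfin : volume (parallelogram t₁ η σ) ≠ ⊤ :=
      ((measure_mono hsub).trans_lt (volume_openSquare_lt_top a)).ne
    calc κ ^ 2 / 4 * (2 * η * σ)
        = ∫ x in parallelogram t₁ η σ, κ ^ 2 / 4 := by
          rw [setIntegral_const, volume_parallelogram hη.le hσ0.le, smul_eq_mul, mul_comm]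
      _ ≤ ∫ x in parallelogram t₁ η σ, q x :=
          setIntegral_mono_on (integrableOn_const hfin) (hqint.mono_set hsub)
            (measurableSet_parallelogram _ _ _) fun x hx => (hpar x hx).2
      _ ≤ ∫ x in openSquare a, q x :=
          setIntegral_mono_set hqint (ae_of_all _ hq0) hsub.eventuallyLE
  have hgain := hmax.integral_raiseGain_nonpos hk0.le hnull
  have hsplit : ∫ x in openSquare a, D.indicator (raiseGain β k u) x =
      (∫ x in openSquare a, N 0 x) + (∫ x in openSquare a, N 1 x) +
      (∫ x in openSquare a, G x) + ∫ x in openSquare a, q x := by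
    have i1 : IntegrableOn (fun x => N 0 x + N 1 x) (openSquare a) := (hNint 0).add (hNint 1)
    have i2 : IntegrableOn (fun x => N 0 x + N 1 x + G x) (openSquare a) := i1.add hGint
    rw [← integral_add (hNint 0) (hNint 1), ← integral_add i1 hGint, ← integral_add i2 hqint]
    refine setIntegral_congr_fun (isOpen_openSquare a).measurableSet fun x hx => ?_
    by_cases hxD : x ∈ D
    · simp only [hN, hq, indicator_of_mem hxD, raiseGain, hGD x hxD]
      ring
    · simp only [hN, hq, indicator_of_notMem hxD, hGn x hx hxD]
      ring
  have hGnn : 0 ≤ ∫ x in openSquare a, G x := integral_nonneg hG0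
  rw [hsplit] at hgain
  -- `κ² η ε / (2 (k + 1))` is gained, at most `(16 M + 8) ρ ε` is lost, and `ρ = 2 ε / κ`
  have e1 : κ ^ 2 / 4 * (2 * η * σ) = κ ^ 2 * η / (2 * (k + 1)) * ε := by
    rw [hσ]; field_simp; ring
  have e2 : (8 * M * ρ + 4 * ρ) * ε * 2 = 4 * (8 * M + 4) / κ * ε * ε := by
    rw [hρ]; field_simp; ring
  have := mul_lt_mul_of_pos_right hs4 hε0
  linarith

/-- Maximality excludes the kink. -/
lemma Ansatz.noKink_of_isProfitMaximizer (h : Ansatz a t₀ t₁ C₀ u)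
    (hmax : IsProfitMaximizer a u) : NoKink a t₁ C₀ u := by
  rcases h.noKink_or_kink hmax.1 with hk | ⟨κ, hκ, hkink⟩
  · exact hk
  · exact absurd hmax (h.not_isProfitMaximizer_of_kink hκ hkink)

end RochetChone

end

theorem lemma1 (a : ℝ) (ha : 0 < a) (t₀ t₁ C₀ : ℝ) (u : RochetChone.Plane → ℝ)
    (hu : RochetChone.Admissible (RochetChone.square a) u)
    (hans : RochetChone.Ansatz a t₀ t₁ C₀ u) :
    ¬ ContDiffOn ℝ 1 u (RochetChone.square a) ∧
      ¬ RochetChone.IsProfitMaximizer a u :=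
  ⟨fun hC => hans.not_noKink hu (hans.noKink_of_contDiffOn hC),
    fun hmax => hans.not_noKink hu (hans.noKink_of_isProfitMaximizer hmax)⟩
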